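/- For $\theta\in\mathbb{R}$ let $\mathbb{C}_\theta=\{s\in\mathbb{C}:\operatorname{Re}s>\theta\}$ and $\mathbb{C}_+=\mathbb{C}_0$. Let $\mathcal{H}^\infty$ be the space of all bounded functions $f:\mathbb{C}_+\to\mathbb{C}$ for which there are complex coefficients $(a_n)_{n\ge1}$ such that the Dirichlet series $\sum_{n=1}^\infty a_n n^{-s}$ converges to $f(s)$ for every $s\in\mathbb{C}_+$, with the norm $\|f\|_\infty=\sup_{s\in\mathbb{C}_+}|f(s)|$. Let $\Phi:\mathbb{C}_+\to\mathbb{C}_+$ be a function for which $C_\Phi f=f\circ\Phi$ defines a bounded linear operator $C_\Phi:\mathcal{H}^\infty\to\mathcal{H}^\infty$. Then the following statements are equivalent: a) $\Phi(\mathbb{C}_+)\subset\mathbb{C}_\varepsilon$ for some $\varepsilon>0$; b) $C_\Phi$ is compact; c) $C_\Phi$ is weakly compact, that is, the image of the closed unit ball is relatively compact in the weak topology of $\mathcal{H}^\infty$; d) $C_\Phi$ does not fix a copy of $\ell^\infty$, that is, there is no linear subspace $Z\subseteq\mathcal{H}^\infty$ such that $Z$ is isomorphic (linearly homeomorphic)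 to the complex sequence space $\ell^\infty$ and $C_\Phi|_Z:Z\to C_\Phi(Z)$ is an isomorphism (linear homeomorphism). -/

import Mathlib

open Filter Topology
open scoped ENNReal

noncomputable section

namespace DirichletHardy

/-- The open half-plane of all complex `s` with `Re s > θ`. -/
def halfPlane (θ : ℝ) : Set ℂ := {s : ℂ | θ < s.re}

/-- The open right half-plane, as a type. -/
abbrev RightHalfPlane : Type := halfPlane 0

/-- The Dirichlet series `∑_{n ≥ 1} a n * n ^ (-s)` converges (as a limit of partial sums, not
necessarily absolutely) to `z` at the point `s`. The value `a 0` plays no role. -/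
def DirichletSeriesConvergesTo (a : ℕ → ℂ) (s z : ℂ) : Prop :=
  Tendsto (fun N : ℕ => ∑ n ∈ Finset.Icc 1 N, a n * (n : ℂ) ^ (-s)) atTop (𝓝 z)

/-- The space of all bounded functions on the right half-plane that are the sum there of an
everywhere convergent Dirichlet series. It is a linear subspace of the space of all bounded
complex functions on the right half-plane and carries the supremum norm. -/
def Hinf : Submodule ℂ (lp (fun _ : RightHalfPlane => ℂ) ∞) where
  carrier := {f | ∃ a : ℕ → ℂ, ∀ s : RightHalfPlane, DirichletSeriesConvergesTo a s (f s)}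
  zero_mem' := by
    refine ⟨0, fun s => ?_⟩
    simp [DirichletSeriesConvergesTo]
  add_mem' := by
    rintro f g ⟨a, ha⟩ ⟨b, hb⟩
    refine ⟨a + b, fun s => ?_⟩
    have h := (ha s).add (hb s)
    simp only [DirichletSeriesConvergesTo, lp.coeFn_add, Pi.add_apply, add_mul,
      Finset.sum_add_distrib]
    exact h
  smul_mem' := by
    rintro c f ⟨a, ha⟩
    refine ⟨c • a, fun s => ?_⟩
    have h := (ha s).const_mul c
    simp only [DirichletSeriesConvergesTo, lp.coeFn_smul, Pi.smul_apply, smul_eq_mul, mul_assoc,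
      ← Finset.mul_sum]
    exact h

/-- The value `f(s)` of an element `f` of `Hinf` at a point `s` of the right half-plane. -/
def valueAt (f : Hinf) (s : RightHalfPlane) : ℂ :=
  (f : lp (fun _ : RightHalfPlane => ℂ) ∞) s

/-- The bounded operator `T` on `Hinf` is the composition operator with symbol `Φ`. -/
def IsCompositionOperator (Φ : RightHalfPlane → RightHalfPlane) (T : Hinf →L[ℂ] Hinf) : Prop :=
  ∀ (f : Hinf) (s : RightHalfPlane), valueAt (T f) s = valueAt f (Φ s)

/-- The complex sequence space `ℓ^∞`. -/
abbrev EllInf : Type := lp (fun _ : ℕ => ℂ) ∞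

section Operators

variable {X Y : Type*} [NormedAddCommGroup X] [NormedSpace ℂ X]
  [NormedAddCommGroup Y] [NormedSpace ℂ Y]

/-- `T` is weakly compact: the image of the closed unit ball is relatively compact in the
weak topology of `Y`. -/
def IsWeaklyCompactOperator (T : X →L[ℂ] Y) : Prop :=
  IsCompact (closure (toWeakSpace ℂ Y '' (T '' Metric.closedBall (0 : X) 1)))

/-- `T` fixes a copy of `E`: there is a subspace `Z` of `X` that is linearly homeomorphic
to `E` and such that `T` restricts to a linear homeomorphism of `Z` onto `T(Z)`. -/
def FixesCopyOf (E : Type*) [NormedAddCommGroup E] [NormedSpace ℂ E] (T : X →L[ℂ] Y) : Prop :=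
  ∃ Z : Submodule ℂ X, Nonempty (Z ≃L[ℂ] E) ∧
    ∃ e : Z ≃L[ℂ] Z.map (T : X →ₗ[ℂ] Y), ∀ z : Z, (e z : Y) = T z

end Operators

end DirichletHardy

end

/-! The implication from a) to b) rests on Bohr's inequality (`exists_norm_partialSum_le_rpow`): on
`Hinf` the N-th partial sum operator has norm O(N ^ η) for every η > 0. It is proved by convolving
along vertical lines with an L¹ kernel whose Fourier transform is 1 at log n for n ≤ N and 0 for n >
N. Summation by parts turns this into convergence on Re s > ε at a rate depending only on ε and the
norm of f. If Φ maps into that half-plane, the operator is therefore a norm limit of finite-rank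
operators.

Compact operators are weakly compact, and a weakly compact operator cannot fix ℓ^∞: a weak cluster
point of the images of the indicators of {0, …, N - 1} would be a norm limit of images of finitely
supported sequences, although all its coordinates equal the same nonzero constant.

For the implication from d) to a), suppose that Re Φ(s_k) → 0. The points 2 ^ (-Φ(s_k)) lie in the
unit disc and, along a subsequence, tend to some ζ on the circle. Functions `peak` attached to a
sparse subsequence are nearly disjoint: at each point of the disc at most one is large. Hence c ↦ ∑
c_j G_j(2 ^ (-s)) embeds ℓ^∞ boundedly in `Hinf`, and the values at the points Φ(s_k) recover c up
to a small error, so composition with Φ is bounded below on the image. Only series in powers of 2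
are needed here, and no structure of Φ. -/

noncomputable section

namespace DirichletHardy

open MeasureTheory

/-! ### Partial sums of Dirichlet series and summation by parts -/

/-- The partial sum `∑_{1 ≤ n ≤ N} a n * n ^ (-s)`. -/
def partialSum (a : ℕ → ℂ) (N : ℕ) (s : ℂ) : ℂ :=
  ∑ n ∈ Finset.Icc 1 N, a n * (n : ℂ) ^ (-s)

lemma partialSum_succ (a : ℕ → ℂ) (N : ℕ) (s : ℂ) :
    partialSum a (N + 1) s = partialSum a N s + a (N + 1) * ((N + 1 : ℕ) : ℂ) ^ (-s) := by
  unfold partialSum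
  rw [Finset.sum_Icc_succ_top (by omega)]

lemma sum_mul_eq_sum_by_parts (b c : ℕ → ℂ) (N : ℕ) :
    ∑ n ∈ Finset.Icc 1 N, b n * c n = (∑ n ∈ Finset.Icc 1 N, b n) * c (N + 1) +
      ∑ n ∈ Finset.Icc 1 N, (∑ k ∈ Finset.Icc 1 n, b k) * (c n - c (n + 1)) := by
  induction N with
  | zero => simp
  | succ N ih =>
    rw [Finset.sum_Icc_succ_top (by omega), ih,
      Finset.sum_Icc_succ_top (f := fun n => (∑ k ∈ Finset.Icc 1 n, b k) * _) (by omega),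
      Finset.sum_Icc_succ_top (by omega)]
    ring

lemma norm_natCast_cpow_neg {n : ℕ} (hn : 1 ≤ n) (w : ℂ) :
    ‖(n : ℂ) ^ (-w)‖ = (n : ℝ) ^ (-w.re) := by
  rw [Complex.norm_natCast_cpow_of_pos (by omega), Complex.neg_re]

/-- Mean value inequality for x ^ (-w) on [n, n + 1]. The extra factor 1 / n makes the sums produced
by summation by parts converge absolutely. -/
lemma norm_cpow_neg_sub_succ_le {n : ℕ} (hn : 1 ≤ n) {w : ℂ} (hw : 0 ≤ w.re) :
    ‖(n : ℂ) ^ (-w) - ((n + 1 : ℕ) : ℂ) ^ (-w)‖ ≤ ‖w‖ * (n : ℝ) ^ (-w.re - 1) := by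
  have hn' : (1 : ℝ) ≤ n := by exact_mod_cast hn
  by_cases hw0 : w = 0
  · simp [hw0]
  have key := Convex.norm_image_sub_le_of_norm_hasDerivWithin_le
    (f := fun x : ℝ => (x : ℂ) ^ (-w)) (f' := fun x : ℝ => (-w) * (x : ℂ) ^ (-w - 1))
    (s := Set.Icc (n : ℝ) (n + 1)) (x := (n : ℝ) + 1) (y := n)
    (C := ‖w‖ * (n : ℝ) ^ (-w.re - 1)) ?_ ?_ (convex_Icc _ _) (by simp) (by simp)
  · simpa using key
  · intro x hx
    have hx0 : x ≠ 0 := by linarith [hx.1]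
    exact (hasDerivAt_ofReal_cpow_const hx0 (neg_ne_zero.2 hw0)).hasDerivWithinAt
  · intro x hx
    have hx0 : 0 < x := by linarith [hx.1]
    rw [norm_mul, norm_neg, Complex.norm_cpow_eq_rpow_re_of_pos hx0]
    gcongr
    simp only [Complex.sub_re, Complex.neg_re, Complex.one_re]
    exact Real.rpow_le_rpow_of_nonpos (by linarith) hx.1 (by linarith)

/-- Abel summation: a bound on the partial sums at s becomes information at s + w. -/
lemma partialSum_add (a : ℕ → ℂ) (N : ℕ) (s w : ℂ) :
    partialSum a N (s + w) = partialSum a N s * ((N + 1 : ℕ) : ℂ) ^ (-w) +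
      ∑ n ∈ Finset.Icc 1 N,
        partialSum a n s * ((n : ℂ) ^ (-w) - ((n + 1 : ℕ) : ℂ) ^ (-w)) := by
  unfold partialSum
  rw [← sum_mul_eq_sum_by_parts (fun n => a n * (n : ℂ) ^ (-s)) (fun n => (n : ℂ) ^ (-w))]
  refine Finset.sum_congr rfl fun n hn => ?_
  have : (n : ℂ) ≠ 0 := by
    have := (Finset.mem_Icc.1 hn).1
    exact_mod_cast (by omega : n ≠ 0)
  rw [neg_add, Complex.cpow_add _ _ this]
  ring

lemma sum_Icc_le_tsum {g : ℕ → ℝ} (hg : Summable g) (h0 : ∀ n, 0 ≤ g n) (N : ℕ) :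
    ∑ n ∈ Finset.Icc 1 N, g n ≤ ∑' n, g n :=
  hg.sum_le_tsum _ fun n _ => h0 n

/-- The partial sums of a Dirichlet series grow at most linearly along a vertical line to the
right of a point of convergence. -/
lemma exists_norm_partialSum_le {a : ℕ → ℂ} {s₀ z : ℂ} (h : DirichletSeriesConvergesTo a s₀ z)
    {σ : ℝ} (hσ : 0 < σ) :
    ∃ C, 0 ≤ C ∧ ∀ (N : ℕ) (u : ℝ),
      ‖partialSum a N (s₀ + (σ + Complex.I * u))‖ ≤ C * (1 + |u|) := by
  obtain ⟨M, hM⟩ : ∃ M, ∀ N, ‖partialSum a N s₀‖ ≤ M := by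
    have := (Metric.isBounded_range_of_tendsto _ h).exists_norm_le
    obtain ⟨M, hM⟩ := this
    exact ⟨M, fun N => hM _ ⟨N, rfl⟩⟩
  have hM0 : 0 ≤ M := (norm_nonneg _).trans (hM 0)
  have hs : Summable fun n : ℕ => (n : ℝ) ^ (-σ - 1) := by
    rw [Real.summable_nat_rpow]; linarith
  set Z := ∑' n : ℕ, (n : ℝ) ^ (-σ - 1)
  have hZ0 : 0 ≤ Z := tsum_nonneg fun n => by positivity
  refine ⟨M * (1 + (1 + σ) * Z), by positivity, fun N u => ?_⟩
  set w : ℂ := σ + Complex.I * u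
  have hre : w.re = σ := by simp [w]
  have hwn : ‖w‖ ≤ (1 + σ) * (1 + |u|) := by
    have : ‖w‖ ≤ σ + |u| := by
      refine (norm_add_le _ _).trans ?_
      simp [abs_of_pos hσ]
    nlinarith [abs_nonneg u]
  rw [partialSum_add]
  have h1 : ‖((N + 1 : ℕ) : ℂ) ^ (-w)‖ ≤ 1 := by
    rw [norm_natCast_cpow_neg (by omega), hre]
    exact Real.rpow_le_one_of_one_le_of_nonpos (by push_cast; linarith [N.cast_nonneg (α := ℝ)])
      (by linarith)
  have h2 : ‖∑ n ∈ Finset.Icc 1 N,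
      partialSum a n s₀ * ((n : ℂ) ^ (-w) - ((n + 1 : ℕ) : ℂ) ^ (-w))‖ ≤ M * (‖w‖ * Z) := by
    calc _ ≤ ∑ n ∈ Finset.Icc 1 N, M * (‖w‖ * (n : ℝ) ^ (-σ - 1)) := by
          refine norm_sum_le_of_le _ fun n hn => ?_
          rw [norm_mul]
          gcongr
          · exact hM n
          · rw [← hre]
            exact norm_cpow_neg_sub_succ_le (Finset.mem_Icc.1 hn).1 (by linarith)
      _ = M * (‖w‖ * ∑ n ∈ Finset.Icc 1 N, (n : ℝ) ^ (-σ - 1)) := by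
          rw [Finset.mul_sum, Finset.mul_sum]
      _ ≤ _ := by
          gcongr
          exact sum_Icc_le_tsum hs (fun n => by positivity) N
  calc _ ≤ M * 1 + M * (‖w‖ * Z) := by
        refine (norm_add_le _ _).trans (add_le_add ?_ h2)
        rw [norm_mul]
        gcongr
        exact hM N
    _ ≤ M * (1 + |u|) + M * ((1 + σ) * (1 + |u|) * Z) := by
        gcongr
        linarith [abs_nonneg u]
    _ = _ := by ring

/-- Tail bound: polynomial growth of the partial sums at `s` gives a rate of convergence at
`s + ε`, depending only on the growth rate. -/
lemma exists_tendsto_zero_norm_sub_partialSum_le {η ε : ℝ} (hη : 0 < η) (hηε : η < ε) :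
    ∃ τ : ℕ → ℝ, Tendsto τ atTop (𝓝 0) ∧ ∀ (a : ℕ → ℂ) (s z : ℂ) (X : ℝ), 0 ≤ X →
      (∀ N, ‖partialSum a N s‖ ≤ X * ((N + 1 : ℕ) : ℝ) ^ η) →
      DirichletSeriesConvergesTo a (s + ε) z → ∀ N, ‖z - partialSum a N (s + ε)‖ ≤ τ N * X := by
  have hε : 0 < ε := hη.trans hηε
  -- Growth of the n-th partial sum times the increment of n ^ (-ε); summable because η < ε. The
  -- term n = 0 vanishes since the real power of 0 with nonzero exponent is 0.
  set t : ℕ → ℝ := fun n => ((n + 1 : ℕ) : ℝ) ^ η * (ε * (n : ℝ) ^ (-ε - 1)) with ht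
  have ht0 : ∀ n, 0 ≤ t n := fun n => by positivity
  have hts : Summable t := by
    have h : Summable fun n : ℕ => (2 : ℝ) ^ η * ε * (n : ℝ) ^ (η + (-ε - 1)) :=
      (Real.summable_nat_rpow.2 (by linarith)).mul_left _
    refine h.of_nonneg_of_le ht0 fun n => ?_
    rcases Nat.eq_zero_or_pos n with rfl | hn
    · simp only [ht, CharP.cast_eq_zero]
      rw [Real.zero_rpow (by linarith : -ε - 1 ≠ 0)]
      simp only [mul_zero]
      positivity
    · have hn' : (1 : ℝ) ≤ n := by exact_mod_cast hn
      calc t n ≤ (2 * (n : ℝ)) ^ η * (ε * (n : ℝ) ^ (-ε - 1)) := by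
            simp only [ht]
            gcongr
            push_cast
            linarith
        _ = _ := by
            rw [Real.mul_rpow (by norm_num) (by positivity), Real.rpow_add (by positivity)]
            ring
  -- Boundary term at N plus the tail of the Abel sums. The boundary term at the upper index M
  -- disappears as M → ∞.
  refine ⟨fun N => ((N + 1 : ℕ) : ℝ) ^ (-(ε - η)) + ∑' k, t (k + (N + 1)), ?_, ?_⟩
  · have h1 : Tendsto (fun N : ℕ => ((N + 1 : ℕ) : ℝ) ^ (-(ε - η))) atTop (𝓝 0) :=
      (tendsto_rpow_neg_atTop (by linarith)).comp
        (tendsto_natCast_atTop_atTop.comp (tendsto_add_atTop_nat 1))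
    have h2 : Tendsto (fun N : ℕ => ∑' k, t (k + (N + 1))) atTop (𝓝 0) :=
      (tendsto_sum_nat_add t).comp (tendsto_add_atTop_nat 1)
    simpa using h1.add h2
  · intro a s z X hX hB hz N
    have hpow : ∀ M : ℕ, ‖partialSum a M s * ((M + 1 : ℕ) : ℂ) ^ (-(ε : ℂ))‖ ≤
        ((M + 1 : ℕ) : ℝ) ^ (-(ε - η)) * X := by
      intro M
      rw [norm_mul, norm_natCast_cpow_neg (by omega), Complex.ofReal_re]
      calc _ ≤ X * ((M + 1 : ℕ) : ℝ) ^ η * ((M + 1 : ℕ) : ℝ) ^ (-ε) := by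
            gcongr
            exact hB M
        _ = _ := by
            rw [mul_assoc, ← Real.rpow_add (by positivity), mul_comm]
            congr 2
            ring
    have hlim : Tendsto (fun M : ℕ => ‖partialSum a M (s + ε) - partialSum a N (s + ε)‖) atTop
        (𝓝 ‖z - partialSum a N (s + ε)‖) := (hz.sub_const _).norm
    have hlim2 : Tendsto (fun M : ℕ => (((M + 1 : ℕ) : ℝ) ^ (-(ε - η)) +
        (((N + 1 : ℕ) : ℝ) ^ (-(ε - η)) + ∑' k, t (k + (N + 1)))) * X) atTop
        (𝓝 ((0 + (((N + 1 : ℕ) : ℝ) ^ (-(ε - η)) + ∑' k, t (k + (N + 1)))) * X)) := by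
      have h1 : Tendsto (fun M : ℕ => ((M + 1 : ℕ) : ℝ) ^ (-(ε - η))) atTop (𝓝 0) :=
        (tendsto_rpow_neg_atTop (by linarith)).comp
          (tendsto_natCast_atTop_atTop.comp (tendsto_add_atTop_nat 1))
      exact (h1.add_const _).mul_const _
    rw [zero_add] at hlim2
    refine le_of_tendsto_of_tendsto hlim hlim2 ?_
    filter_upwards [eventually_ge_atTop N] with M hM
    rw [partialSum_add, partialSum_add]
    set Δ : ℕ → ℂ := fun n => (n : ℂ) ^ (-(ε : ℂ)) - ((n + 1 : ℕ) : ℂ) ^ (-(ε : ℂ)) with hΔ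
    have hsplit : ∑ n ∈ Finset.Icc 1 M, partialSum a n s * Δ n =
        ∑ n ∈ Finset.Icc 1 N, partialSum a n s * Δ n +
          ∑ k ∈ Finset.range (M - N), partialSum a (k + (N + 1)) s * Δ (k + (N + 1)) := by
      clear hlim hlim2
      induction M, hM using Nat.le_induction with
      | base => simp
      | succ M hM ih =>
        rw [Finset.sum_Icc_succ_top (by omega), ih, Nat.succ_sub hM, Finset.sum_range_succ,
          show M - N + (N + 1) = M + 1 by omega, add_assoc]
    have htail : ‖∑ k ∈ Finset.range (M - N), partialSum a (k + (N + 1)) s * Δ (k + (N + 1))‖ ≤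
        (∑' k, t (k + (N + 1))) * X := by
      calc _ ≤ ∑ k ∈ Finset.range (M - N), t (k + (N + 1)) * X := by
            refine norm_sum_le_of_le _ fun k _ => ?_
            rw [norm_mul]
            have h1 := hB (k + (N + 1))
            have h2 := norm_cpow_neg_sub_succ_le (n := k + (N + 1)) (by omega) (w := (ε : ℂ))
              (by simpa using hε.le)
            rw [Complex.norm_real, Real.norm_of_nonneg hε.le, Complex.ofReal_re] at h2
            calc _ ≤ (X * _) * _ := mul_le_mul h1 h2 (norm_nonneg _) (by positivity)
              _ = _ := by simp only [ht]; ring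
        _ = (∑ k ∈ Finset.range (M - N), t (k + (N + 1))) * X := by rw [Finset.sum_mul]
        _ ≤ _ := by
            gcongr
            exact ((summable_nat_add_iff (N + 1)).2 hts).sum_le_tsum _ fun n _ => ht0 _
    rw [hsplit]
    calc _ = ‖partialSum a M s * ((M + 1 : ℕ) : ℂ) ^ (-(ε : ℂ)) -
          partialSum a N s * ((N + 1 : ℕ) : ℂ) ^ (-(ε : ℂ)) +
          ∑ k ∈ Finset.range (M - N), partialSum a (k + (N + 1)) s * Δ (k + (N + 1))‖ := by
          congr 1; ring
      _ ≤ _ := (norm_add_le _ _).trans (add_le_add (norm_sub_le _ _) le_rfl)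
      _ ≤ _ := by linarith [hpow M, hpow N, htail]

/-! ### A kernel whose Fourier transform is a trapezoid -/

lemma integrable_one_sub_cos_div_sq : Integrable fun u : ℝ => (1 - Real.cos u) / u ^ 2 := by
  refine (integrable_inv_one_add_sq.const_mul 4).mono'
    (by fun_prop : Measurable fun u : ℝ => (1 - Real.cos u) / u ^ 2).aestronglyMeasurable
    (ae_of_all _ fun u => ?_)
  have h1 : 1 - Real.cos u ≤ u ^ 2 / 2 := by linarith [Real.one_sub_sq_div_two_le_cos (x := u)]
  have h2 := Real.cos_le_one u
  have h3 := Real.neg_one_le_cos u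
  rw [Real.norm_of_nonneg (by have := sub_nonneg.2 h2; positivity)]
  by_cases hu : u = 0
  · simp [hu]
  · rw [← div_eq_mul_inv, div_le_div_iff₀ (by positivity) (by positivity)]
    nlinarith [sq_nonneg u]

/-- The constant `∫ (1 - cos u) / u ^ 2 du` (equal to `π`). -/
def cosConst : ℝ := ∫ u : ℝ, (1 - Real.cos u) / u ^ 2

/-- Positivity suffices: the exact value cancels in the normalisation of `trapezoidKernel`. -/
lemma cosConst_pos : 0 < cosConst := by
  unfold cosConst
  have hnn : ∀ u : ℝ, 0 ≤ (1 - Real.cos u) / u ^ 2 := fun u => by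
    have := sub_nonneg.2 (Real.cos_le_one u)
    positivity
  rw [integral_pos_iff_support_of_nonneg hnn integrable_one_sub_cos_div_sq]
  refine lt_of_lt_of_le ?_ (measure_mono (s := Set.Ioo 0 1) ?_)
  · simp
  · intro u hu
    have h := Real.cos_lt_cos_of_nonneg_of_le_pi (x := 0) (y := u) le_rfl
      (by linarith [hu.2, Real.pi_gt_three]) hu.1
    rw [Real.cos_zero] at h
    have h2 : 0 < u := hu.1
    have : 0 < (1 - Real.cos u) / u ^ 2 := div_pos (by linarith) (by positivity)
    exact this.ne'

lemma integrable_one_sub_cos_mul_div_sq (a : ℝ) :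
    Integrable fun u : ℝ => (1 - Real.cos (a * u)) / u ^ 2 := by
  by_cases ha : a = 0
  · simp [ha]
  have h := (integrable_one_sub_cos_div_sq.comp_mul_left' ha).const_mul (a ^ 2)
  refine h.congr (ae_of_all _ fun u => ?_)
  simp only
  rw [mul_pow]
  by_cases hu : u = 0
  · simp [hu]
  · field_simp

/-- Rescaling of u. The answer being proportional to |a|, combinations of such kernels have
piecewise linear Fourier transforms. -/
lemma integral_one_sub_cos_mul_div_sq (a : ℝ) :
    ∫ u : ℝ, (1 - Real.cos (a * u)) / u ^ 2 = |a| * cosConst := by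
  by_cases ha : a = 0
  · simp [ha]
  have h := Measure.integral_comp_mul_left (fun u : ℝ => (1 - Real.cos u) / u ^ 2) a
  have h2 : (fun u : ℝ => (1 - Real.cos (a * u)) / u ^ 2) =
      fun u : ℝ => a ^ 2 * ((1 - Real.cos (a * u)) / (a * u) ^ 2) := by
    ext u
    rw [mul_pow]
    by_cases hu : u = 0
    · simp [hu]
    · field_simp
  rw [h2, integral_const_mul, h, smul_eq_mul, ← cosConst, ← mul_assoc, abs_inv, ← sq_abs]
  congr 1
  have : |a| ≠ 0 := abs_ne_zero.2 ha
  field_simp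

/-- The kernel whose Fourier transform is `1` on `[-p, p]`, `0` outside `[-q, q]` and affine
in between. -/
def trapezoidKernel (p q u : ℝ) : ℝ :=
  (Real.cos (p * u) - Real.cos (q * u)) / u ^ 2 / ((q - p) * cosConst)

lemma integrable_trapezoidKernel (p q : ℝ) : Integrable (trapezoidKernel p q) := by
  have h := ((integrable_one_sub_cos_mul_div_sq q).sub
    (integrable_one_sub_cos_mul_div_sq p)).div_const ((q - p) * cosConst)
  refine h.congr (ae_of_all _ fun u => ?_)
  simp only [Pi.sub_apply, trapezoidKernel]
  ring

/-- The product-to-sum formula splits the integrand into four terms of the form (1 - cos(a u)) / u²,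
each contributing an absolute value. -/
lemma integral_trapezoidKernel_mul_cos (p q x : ℝ) :
    ∫ u, trapezoidKernel p q u * Real.cos (x * u) =
      (|q + x| + |q - x| - |p + x| - |p - x|) / (2 * (q - p)) := by
  have hc := cosConst_pos.ne'
  have I := integrable_one_sub_cos_mul_div_sq
  have h : (fun u => trapezoidKernel p q u * Real.cos (x * u)) = fun u =>
      ((1 - Real.cos ((q + x) * u)) / u ^ 2 + (1 - Real.cos ((q - x) * u)) / u ^ 2 -
        (1 - Real.cos ((p + x) * u)) / u ^ 2 - (1 - Real.cos ((p - x) * u)) / u ^ 2) /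
        (2 * (q - p) * cosConst) := by
    ext u
    unfold trapezoidKernel
    rw [add_mul q x u, add_mul p x u, sub_mul q x u, sub_mul p x u, Real.cos_add, Real.cos_add,
      Real.cos_sub, Real.cos_sub]
    by_cases hpq : q - p = 0
    · simp [hpq]
    by_cases hu : u = 0
    · simp [hu]
    field_simp
    ring
  have hI1 : Integrable fun u : ℝ =>
      (1 - Real.cos ((q + x) * u)) / u ^ 2 + (1 - Real.cos ((q - x) * u)) / u ^ 2 :=
    (I _).add (I _)
  have hI2 : Integrable fun u : ℝ =>
      (1 - Real.cos ((q + x) * u)) / u ^ 2 + (1 - Real.cos ((q - x) * u)) / u ^ 2 -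
      (1 - Real.cos ((p + x) * u)) / u ^ 2 := hI1.sub (I _)
  rw [h, integral_div, integral_sub hI2 (I _), integral_sub hI1 (I _), integral_add (I _) (I _)]
  simp only [integral_one_sub_cos_mul_div_sq]
  by_cases hpq : q - p = 0
  · simp [hpq]
  field_simp

/-- The kernel is even, so symmetrising in u reduces the exponential to a cosine. -/
lemma integral_trapezoidKernel_mul_exp (p q x : ℝ) :
    ∫ u : ℝ, Complex.exp (-(Complex.I * u * x)) * (trapezoidKernel p q u : ℂ) =
      (((|q + x| + |q - x| - |p + x| - |p - x|) / (2 * (q - p)) : ℝ) : ℂ) := by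
  set J : ℝ → ℂ := fun u => Complex.exp (-(Complex.I * u * x)) * (trapezoidKernel p q u : ℂ)
    with hJ
  have hJi : Integrable J := by
    refine (integrable_trapezoidKernel p q).norm.mono' ?_ (ae_of_all _ fun u => ?_)
    · exact (by fun_prop : Continuous fun u : ℝ => Complex.exp (-(Complex.I * u * x))
        ).aestronglyMeasurable.mul
        (integrable_trapezoidKernel p q).ofReal.aestronglyMeasurable
    · simp only [hJ]
      rw [norm_mul, Complex.norm_exp, Complex.norm_real]
      simp
  have h1 : ∫ u, J (-u) = ∫ u, J u := integral_neg_eq_self J volume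
  have h2 : ∫ u, (J u + J (-u)) = 2 * ∫ u, J u := by
    rw [integral_add hJi hJi.comp_neg, h1]; ring
  have h3 : (fun u => J u + J (-u)) = fun u =>
      ((2 * (trapezoidKernel p q u * Real.cos (x * u)) : ℝ) : ℂ) := by
    ext u
    have hk : trapezoidKernel p q (-u) = trapezoidKernel p q u := by
      simp [trapezoidKernel]
    simp only [hJ, hk]
    push_cast
    rw [Complex.cos]
    have e1 : -(Complex.I * u * x) = -(x * u) * Complex.I := by ring
    have e2 : -(Complex.I * -u * x) = (x * u) * Complex.I := by ring
    rw [e1, e2]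
    ring
  rw [h3, integral_complex_ofReal, integral_const_mul, integral_trapezoidKernel_mul_cos] at h2
  rw [Complex.ofReal_mul] at h2
  exact (mul_left_cancel₀ (two_ne_zero) (by exact_mod_cast h2)).symm

lemma trapezoid_eq_one {p q x : ℝ} (hpq : p < q) (hx : 0 ≤ x) (hxp : x ≤ p) :
    (|q + x| + |q - x| - |p + x| - |p - x|) / (2 * (q - p)) = 1 := by
  rw [abs_of_nonneg (by linarith), abs_of_nonneg (by linarith), abs_of_nonneg (by linarith),
    abs_of_nonneg (by linarith), div_eq_one_iff_eq (by linarith)]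
  ring

lemma trapezoid_eq_zero {p q x : ℝ} (hp : 0 ≤ p) (hpq : p < q) (hxq : q ≤ x) :
    (|q + x| + |q - x| - |p + x| - |p - x|) / (2 * (q - p)) = 0 := by
  rw [abs_of_nonneg (by linarith : 0 ≤ q + x), abs_of_nonpos (by linarith : q - x ≤ 0),
    abs_of_nonneg (by linarith : 0 ≤ p + x), abs_of_nonpos (by linarith : p - x ≤ 0)]
  ring

/-- For |u| ≤ 1: u² cancels the singularity of the kernel and q - p its normalisation. -/
lemma abs_cos_sub_cos_le (p q u : ℝ) (hp : 0 ≤ p) (hpq : p ≤ q) :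
    |Real.cos (p * u) - Real.cos (q * u)| ≤ (q - p) * (q + p) / 2 * u ^ 2 := by
  rw [Real.cos_sub_cos, abs_mul, abs_mul]
  have h1 : |Real.sin ((p * u + q * u) / 2)| ≤ (q + p) / 2 * |u| := by
    refine Real.abs_sin_le_abs.trans (le_of_eq ?_)
    rw [show (p * u + q * u) / 2 = (q + p) / 2 * u by ring, abs_mul,
      abs_of_nonneg (by linarith : 0 ≤ (q + p) / 2)]
  have h2 : |Real.sin ((p * u - q * u) / 2)| ≤ (q - p) / 2 * |u| := by
    refine Real.abs_sin_le_abs.trans (le_of_eq ?_)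
    rw [show (p * u - q * u) / 2 = -((q - p) / 2 * u) by ring, abs_neg, abs_mul,
      abs_of_nonneg (by linarith : 0 ≤ (q - p) / 2)]
  have : |(-2 : ℝ)| = 2 := by norm_num
  rw [this]
  calc _ ≤ 2 * ((q + p) / 2 * |u|) * ((q - p) / 2 * |u|) := by
        have : 0 ≤ q + p := by linarith
        gcongr
    _ = _ := by rw [← sq_abs u]; ring

/-- For |u| ≥ 1: interpolating between the bounds 2 and (q - p)|u| leaves the integrable decay |u| ^
(-1 - η) in the kernel, at the cost of (q - p) ^ (-η). -/
lemma abs_cos_sub_cos_le_rpow (p q u : ℝ) (hpq : p ≤ q) {η : ℝ} (hη : 0 ≤ η) (hη1 : η ≤ 1) :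
    |Real.cos (p * u) - Real.cos (q * u)| ≤ 2 * ((q - p) * |u|) ^ (1 - η) := by
  set t := (q - p) * |u|
  have ht : 0 ≤ t := mul_nonneg (by linarith) (abs_nonneg _)
  have h1 : |Real.cos (p * u) - Real.cos (q * u)| ≤ 2 := by
    have := Real.abs_cos_le_one (p * u)
    have := Real.abs_cos_le_one (q * u)
    exact (abs_sub _ _).trans (by linarith)
  have h2 : |Real.cos (p * u) - Real.cos (q * u)| ≤ t := by
    rw [Real.cos_sub_cos, abs_mul, abs_mul]
    have h2 : |Real.sin ((p * u - q * u) / 2)| ≤ t / 2 := by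
      refine Real.abs_sin_le_abs.trans (le_of_eq ?_)
      rw [show (p * u - q * u) / 2 = -((q - p) / 2 * u) by ring, abs_neg, abs_mul,
        abs_of_nonneg (by linarith : 0 ≤ (q - p) / 2)]
      ring
    have h3 := Real.abs_sin_le_one ((p * u + q * u) / 2)
    have : |(-2 : ℝ)| = 2 := by norm_num
    rw [this]
    nlinarith [abs_nonneg (Real.sin ((p * u + q * u) / 2)),
      abs_nonneg (Real.sin ((p * u - q * u) / 2))]
  rcases le_total t 1 with h | h
  · have : t ≤ t ^ (1 - η) := by
      rcases ht.eq_or_lt with h0 | h0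
      · rw [← h0]; positivity
      · calc t = t ^ (1 : ℝ) := (Real.rpow_one t).symm
          _ ≤ _ := Real.rpow_le_rpow_of_exponent_ge h0 h (by linarith)
    linarith
  · have : 1 ≤ t ^ (1 - η) := Real.one_le_rpow h (by linarith)
    linarith

/-- The `L¹` norm of the kernel separating `N` from `N + 1` is `O(N ^ η)` for every `η > 0`. -/
lemma exists_integral_norm_trapezoidKernel_le {η : ℝ} (hη : 0 < η) (hη1 : η ≤ 1) :
    ∃ C, 0 ≤ C ∧ ∀ N : ℕ, 1 ≤ N →
      ∫ u, ‖trapezoidKernel (Real.log N) (Real.log (N + 1 : ℕ)) u‖ ≤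
        C * ((N + 1 : ℕ) : ℝ) ^ η := by
  have hc := cosConst_pos
  set G : ℝ → ℝ := fun u => (1 + ‖u‖) ^ (-(1 + η)) with hG
  have hGi : Integrable G := integrable_one_add_norm (by simp; exact hη)
  -- The term 1 / η comes from log(N + 1) ≤ (N + 1) ^ η / η, the 2 from the range |u| ≥ 1, and 2 ^
  -- (1 + η) from comparing 1 or |u| with 1 + |u|.
  set A : ℝ := (1 / η + 2) / cosConst * 2 ^ (1 + η)
  have hA : 0 ≤ A := by positivity
  refine ⟨A * ∫ u, G u, mul_nonneg hA (integral_nonneg fun u => by simp only [hG]; positivity),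
    fun N hN => ?_⟩
  set p := Real.log N
  set q := Real.log (N + 1 : ℕ)
  set Y : ℝ := ((N + 1 : ℕ) : ℝ) ^ η with hY
  have hN' : (1 : ℝ) ≤ N := by exact_mod_cast hN
  have hp : 0 ≤ p := Real.log_nonneg hN'
  have hpq : p < q := Real.log_lt_log (by linarith) (by push_cast; linarith)
  have hqp : 0 < q - p := by linarith
  have hqY : q ≤ Y / η := Real.log_le_rpow_div (by positivity) hη
  -- The gap log((N + 1) / N) is at least 1 / (N + 1).
  have hdY : (q - p) ^ (-η) ≤ Y := by
    have h : (((N + 1 : ℕ) : ℝ))⁻¹ ≤ q - p := by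
      simp only [p, q]
      rw [← Real.log_div (by positivity) (by positivity)]
      have := Real.one_sub_inv_le_log_of_pos (x := ((N + 1 : ℕ) : ℝ) / N) (by positivity)
      refine le_trans (le_of_eq ?_) this
      push_cast
      field_simp
      ring
    calc (q - p) ^ (-η) ≤ ((((N + 1 : ℕ) : ℝ))⁻¹) ^ (-η) :=
          Real.rpow_le_rpow_of_nonpos (by positivity) h (by linarith)
      _ = Y := by rw [Real.inv_rpow (by positivity), Real.rpow_neg (by positivity), inv_inv]
  have hY0 : 0 ≤ Y := by positivity
  have hbound : ∀ u, ‖trapezoidKernel p q u‖ ≤ A * Y * G u := by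
    intro u
    have hn : ‖trapezoidKernel p q u‖ =
        |Real.cos (p * u) - Real.cos (q * u)| / u ^ 2 / ((q - p) * cosConst) := by
      unfold trapezoidKernel
      rw [norm_div, norm_div, Real.norm_eq_abs, Real.norm_of_nonneg (sq_nonneg u),
        Real.norm_of_nonneg (by positivity)]
    by_cases hu0 : u = 0
    · rw [hn]
      simp only [hu0, hG]
      simp
      positivity
    have hua : 0 < |u| := abs_pos.2 hu0
    rw [hn]
    rcases le_total |u| 1 with hu | hu
    · have h1 : (1 : ℝ) ≤ 2 ^ (1 + η) * G u := by
        simp only [hG]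
        rw [Real.rpow_neg (by positivity), ← div_eq_mul_inv, le_div_iff₀ (by positivity), one_mul]
        refine Real.rpow_le_rpow (by positivity) ?_ (by positivity)
        rw [Real.norm_eq_abs]; linarith
      calc |Real.cos (p * u) - Real.cos (q * u)| / u ^ 2 / ((q - p) * cosConst)
          ≤ ((q - p) * (q + p) / 2 * u ^ 2) / u ^ 2 / ((q - p) * cosConst) := by
            gcongr
            exact abs_cos_sub_cos_le p q u hp hpq.le
        _ = (q + p) / 2 / cosConst := by field_simp
        _ ≤ (Y / η + 2 * Y) / cosConst := by
            gcongr
            linarith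
        _ = ((1 / η + 2) / cosConst * Y) * 1 := by ring
        _ ≤ ((1 / η + 2) / cosConst * Y) * (2 ^ (1 + η) * G u) := by gcongr
        _ = _ := by simp only [A]; ring
    · have h1 : |u| ^ (-(1 + η)) ≤ 2 ^ (1 + η) * G u := by
        simp only [hG]
        rw [Real.rpow_neg (by positivity), Real.rpow_neg (by positivity), ← div_eq_mul_inv,
          inv_eq_one_div, div_le_div_iff₀ (by positivity) (by positivity), one_mul,
          ← Real.mul_rpow (by norm_num) (by positivity)]
        refine Real.rpow_le_rpow (by positivity) ?_ (by positivity)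
        rw [Real.norm_eq_abs]; linarith
      calc |Real.cos (p * u) - Real.cos (q * u)| / u ^ 2 / ((q - p) * cosConst)
          ≤ (2 * ((q - p) * |u|) ^ (1 - η)) / u ^ 2 / ((q - p) * cosConst) := by
            gcongr
            exact abs_cos_sub_cos_le_rpow p q u hpq.le hη.le hη1
        _ = 2 / cosConst * (q - p) ^ (-η) * |u| ^ (-(1 + η)) := by
            rw [Real.mul_rpow hqp.le hua.le, ← sq_abs u]
            have e1 : (q - p) ^ (1 - η) = (q - p) * (q - p) ^ (-η) := by
              rw [show 1 - η = 1 + -η by ring, Real.rpow_add hqp, Real.rpow_one]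
            have e2 : |u| ^ (1 - η) = |u| ^ 2 * |u| ^ (-(1 + η)) := by
              rw [← Real.rpow_two, ← Real.rpow_add hua]; congr 1; ring
            rw [e1, e2]
            field_simp
        _ ≤ 2 / cosConst * Y * (2 ^ (1 + η) * G u) := by gcongr
        _ ≤ (1 / η + 2) / cosConst * Y * (2 ^ (1 + η) * G u) := by
            have : 0 ≤ G u := by simp only [hG]; positivity
            gcongr
            have : 0 ≤ 1 / η := by positivity
            linarith
        _ = _ := by simp only [A]; ring
  calc _ ≤ ∫ u, A * Y * G u :=
        integral_mono (integrable_trapezoidKernel p q).norm (hGi.const_mul _) hbound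
    _ = _ := by rw [integral_const_mul]; ring

/-! ### Vertical convolutions and Bohr's inequality -/

lemma natCast_cpow_neg_add_I_mul {n : ℕ} (hn : 1 ≤ n) (s : ℂ) (u : ℝ) :
    (n : ℂ) ^ (-(s + Complex.I * u)) =
      (n : ℂ) ^ (-s) * Complex.exp (-(Complex.I * u * (Real.log n : ℝ))) := by
  have h0 : (n : ℂ) ≠ 0 := by exact_mod_cast (by omega : n ≠ 0)
  rw [neg_add, Complex.cpow_add _ _ h0, Complex.cpow_def_of_ne_zero h0 (-(Complex.I * u)),
    ← Complex.natCast_log]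
  congr 2
  ring

lemma continuous_partialSum (a : ℕ → ℂ) (N : ℕ) (s : ℂ) :
    Continuous fun u : ℝ => partialSum a N (s + Complex.I * u) := by
  unfold partialSum
  refine continuous_finsetSum _ fun n hn => continuous_const.mul ?_
  have h0 : (n : ℂ) ≠ 0 := by
    have := (Finset.mem_Icc.1 hn).1
    exact_mod_cast (by omega : n ≠ 0)
  exact (by fun_prop : Continuous fun u : ℝ => -(s + Complex.I * u)).const_cpow (Or.inl h0)

lemma integral_partialSum_mul (a : ℕ → ℂ) (N : ℕ) (s : ℂ) {K : ℝ → ℂ} (hK : Integrable K) :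
    ∫ u : ℝ, partialSum a N (s + Complex.I * u) * K u = ∑ n ∈ Finset.Icc 1 N,
      a n * (n : ℂ) ^ (-s) *
        ∫ u : ℝ, Complex.exp (-(Complex.I * u * (Real.log n : ℝ))) * K u := by
  have hint : ∀ x : ℝ, Integrable fun u : ℝ => Complex.exp (-(Complex.I * u * x)) * K u := by
    intro x
    refine hK.norm.mono' ?_ (ae_of_all _ fun u => ?_)
    · exact (by fun_prop : Continuous fun u : ℝ => Complex.exp (-(Complex.I * u * x))
        ).aestronglyMeasurable.mul hK.aestronglyMeasurable
    · rw [norm_mul, Complex.norm_exp]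
      simp
  calc _ = ∫ u : ℝ, ∑ n ∈ Finset.Icc 1 N, a n * (n : ℂ) ^ (-s) *
        (Complex.exp (-(Complex.I * u * (Real.log n : ℝ))) * K u) := by
        congr 1
        ext u
        rw [partialSum, Finset.sum_mul]
        refine Finset.sum_congr rfl fun n hn => ?_
        rw [natCast_cpow_neg_add_I_mul (Finset.mem_Icc.1 hn).1]
        ring
    _ = _ := by
        rw [integral_finsetSum _ fun n _ => (hint _).const_mul _]
        simp only [integral_const_mul]

/-- Convolving with K along a vertical line multiplies the n-th coefficient by the Fourier transform
of K at log n; dominated convergence justifies this for the whole series. -/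
lemma tendsto_sum_mul_integral_exp {a : ℕ → ℂ} {s : ℂ} {F K : ℝ → ℂ} {β : ℝ → ℝ}
    (hF : ∀ u : ℝ, DirichletSeriesConvergesTo a (s + Complex.I * u) (F u))
    (hβ : ∀ (N : ℕ) (u : ℝ), ‖partialSum a N (s + Complex.I * u)‖ ≤ β u)
    (hK : Integrable K) (hβK : Integrable fun u => β u * ‖K u‖) :
    Tendsto (fun N : ℕ => ∑ n ∈ Finset.Icc 1 N, a n * (n : ℂ) ^ (-s) *
        ∫ u : ℝ, Complex.exp (-(Complex.I * u * (Real.log n : ℝ))) * K u) atTop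
      (𝓝 (∫ u, F u * K u)) := by
  simp only [← integral_partialSum_mul a _ s hK]
  refine tendsto_integral_of_dominated_convergence _ (fun N => ?_) hβK
    (fun N => ae_of_all _ fun u => ?_) (ae_of_all _ fun u => ?_)
  · exact (continuous_partialSum a N s).aestronglyMeasurable.mul hK.aestronglyMeasurable
  · rw [norm_mul]
    exact mul_le_mul_of_nonneg_right (hβ N u) (norm_nonneg _)
  · exact (hF u).mul_const _

lemma norm_integral_mul_le {F K : ℝ → ℂ} {M : ℝ} (hF : ∀ u, ‖F u‖ ≤ M) (hK : Integrable K) :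
    ‖∫ u, F u * K u‖ ≤ M * ∫ u, ‖K u‖ := by
  rw [← integral_const_mul]
  refine norm_integral_le_of_norm_le (hK.norm.const_mul M) (ae_of_all _ fun u => ?_)
  rw [norm_mul]
  exact mul_le_mul_of_nonneg_right (hF u) (norm_nonneg _)

/-- The sequence `a` consists of Dirichlet coefficients of `f`. -/
def IsCoeff (f : Hinf) (a : ℕ → ℂ) : Prop :=
  ∀ s : RightHalfPlane, DirichletSeriesConvergesTo a s (valueAt f s)

lemma exists_isCoeff (f : Hinf) : ∃ a, IsCoeff f a := f.2

lemma norm_valueAt_le (f : Hinf) (s : RightHalfPlane) : ‖valueAt f s‖ ≤ ‖f‖ :=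
  lp.norm_apply_le_norm ENNReal.top_ne_zero _ s

/-- The coefficients `a` damped by a Gaussian in `log n`. -/
def damp (b : ℝ) (a : ℕ → ℂ) (n : ℕ) : ℂ :=
  a n * (Real.exp (-(Real.log n) ^ 2 / (4 * b)) : ℝ)

lemma integral_exp_mul_gaussian {b : ℝ} (hb : 0 < b) (x : ℝ) :
    ∫ u : ℝ, Complex.exp (-(Complex.I * u * x)) * (Real.exp (-b * u ^ 2) : ℝ) =
      (√(Real.pi / b) : ℝ) * (Real.exp (-x ^ 2 / (4 * b)) : ℝ) := by
  have h := fourierIntegral_gaussian (b := b) (by simpa using hb) (-x)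
  have e1 : (fun u : ℝ => Complex.exp (Complex.I * -x * u) * Complex.exp (-(b : ℂ) * u ^ 2)) =
      fun u : ℝ => Complex.exp (-(Complex.I * u * x)) * (Real.exp (-b * u ^ 2) : ℝ) := by
    ext u
    push_cast
    congr 2
    ring
  rw [e1] at h
  rw [h, Real.sqrt_eq_rpow, Complex.ofReal_cpow (by positivity)]
  push_cast
  congr 3
  ring

lemma mem_halfPlane {θ : ℝ} {s : ℂ} : s ∈ halfPlane θ ↔ θ < s.re := Iff.rfl

lemma re_add_I_mul (s : ℂ) (u : ℝ) : (s + Complex.I * u).re = s.re := by simp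

lemma IsCoeff.exists_norm_partialSum_le {f : Hinf} {a : ℕ → ℂ} (ha : IsCoeff f a) {s : ℂ}
    (hs : 0 < s.re) :
    ∃ C, 0 ≤ C ∧ ∀ (N : ℕ) (u : ℝ), ‖partialSum a N (s + Complex.I * u)‖ ≤ C * (1 + |u|) := by
  obtain ⟨C, hC0, hC⟩ := DirichletHardy.exists_norm_partialSum_le (σ := s.re / 2)
    (ha ⟨s - (s.re / 2 : ℝ), by
      rw [mem_halfPlane, Complex.sub_re, Complex.ofReal_re]; linarith⟩)
    (by linarith)
  refine ⟨C, hC0, fun N u => ?_⟩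
  convert hC N u using 3
  push_cast
  ring

/-- Gaussian convolution along vertical lines. -/
lemma IsCoeff.exists_damp {f : Hinf} {a : ℕ → ℂ} (ha : IsCoeff f a) {b : ℝ} (hb : 0 < b) {s : ℂ}
    (hs : 0 < s.re) : ∃ z, ‖z‖ ≤ ‖f‖ ∧ DirichletSeriesConvergesTo (damp b a) s z := by
  obtain ⟨C, hC0, hC⟩ := ha.exists_norm_partialSum_le hs
  set r : ℝ := √(Real.pi / b)
  have hr : 0 < r := Real.sqrt_pos.2 (by positivity)
  -- The L¹ norm is 1, so the supremum bound is preserved, and the Gaussian absorbs the linear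
  -- growth of the partial sums.
  set K : ℝ → ℂ := fun u => (r⁻¹ : ℝ) * (Real.exp (-b * u ^ 2) : ℝ) with hKdef
  have hg := integrable_exp_neg_mul_sq hb
  have hK : Integrable K := hg.ofReal.const_mul _
  have hKn : ∀ u, ‖K u‖ = r⁻¹ * Real.exp (-b * u ^ 2) := fun u => by
    simp only [hKdef]
    rw [← Complex.ofReal_mul, Complex.norm_real, Real.norm_of_nonneg (by positivity)]
  have hK1 : ∫ u, ‖K u‖ = 1 := by
    simp only [hKn]
    rw [integral_const_mul, integral_gaussian]
    exact inv_mul_cancel₀ hr.ne'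
  have hKx : ∀ x : ℝ, ∫ u : ℝ, Complex.exp (-(Complex.I * u * x)) * K u =
      (Real.exp (-x ^ 2 / (4 * b)) : ℝ) := by
    intro x
    have : (fun u : ℝ => Complex.exp (-(Complex.I * u * x)) * K u) = fun u : ℝ =>
        ((r⁻¹ : ℝ) : ℂ) * (Complex.exp (-(Complex.I * u * x)) * (Real.exp (-b * u ^ 2) : ℝ)) := by
      ext u
      simp only [hKdef]
      ring
    rw [this, integral_const_mul, integral_exp_mul_gaussian hb, ← mul_assoc, ← Complex.ofReal_mul,
      inv_mul_cancel₀ hr.ne', Complex.ofReal_one, one_mul]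
  have hβK : Integrable fun u : ℝ => (C * (1 + |u|)) * ‖K u‖ := by
    simp only [hKn]
    have h1 := (integrable_mul_exp_neg_mul_sq hb).norm
    refine ((hg.add h1).const_mul (C * r⁻¹)).congr (ae_of_all _ fun u => ?_)
    simp only [Pi.add_apply, norm_mul, Real.norm_eq_abs, Real.abs_exp]
    ring
  obtain ⟨F, hFn, hF⟩ : ∃ F : ℝ → ℂ, (∀ u, ‖F u‖ ≤ ‖f‖) ∧
      ∀ u : ℝ, DirichletSeriesConvergesTo a (s + Complex.I * u) (F u) := by
    have hre : ∀ u : ℝ, s + Complex.I * u ∈ halfPlane 0 := fun u => by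
      rw [mem_halfPlane, re_add_I_mul]; exact hs
    exact ⟨fun u => valueAt f ⟨_, hre u⟩, fun u => norm_valueAt_le f ⟨_, hre u⟩,
      fun u => ha ⟨_, hre u⟩⟩
  refine ⟨∫ u, F u * K u, ?_, ?_⟩
  · have := norm_integral_mul_le hFn hK
    rwa [hK1, mul_one] at this
  · have := tendsto_sum_mul_integral_exp (a := a) (s := s) hF hC hK hβK
    simp only [hKx] at this
    unfold DirichletSeriesConvergesTo damp
    refine this.congr fun N => Finset.sum_congr rfl fun n _ => by ring

/-- Expand (log n - 4b)² ≥ 0. -/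
lemma exp_neg_log_sq_le {b : ℝ} (hb : 0 < b) {n : ℕ} (hn : 1 ≤ n) :
    Real.exp (-(Real.log n) ^ 2 / (4 * b)) ≤ Real.exp (4 * b) * (n : ℝ) ^ (-2 : ℝ) := by
  rw [Real.rpow_def_of_pos (by exact_mod_cast hn), ← Real.exp_add]
  refine Real.exp_le_exp.2 ?_
  rw [div_le_iff₀ (by positivity)]
  nlinarith [sq_nonneg (Real.log n - 4 * b)]

/-- Purpose of the damping: the trapezoid kernel decays too slowly to absorb linear growth in u, but
damped series converge absolutely, so their partial sums are bounded on vertical lines. -/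
lemma IsCoeff.exists_norm_partialSum_damp_le {f : Hinf} {a : ℕ → ℂ} (ha : IsCoeff f a) {b : ℝ}
    (hb : 0 < b) {s : ℂ} (hs : 0 < s.re) :
    ∃ C, ∀ (N : ℕ) (u : ℝ), ‖partialSum (damp b a) N (s + Complex.I * u)‖ ≤ C := by
  obtain ⟨C, hC0, hC⟩ := ha.exists_norm_partialSum_le hs
  have hS : ∀ N, ‖partialSum a N s‖ ≤ C := fun N => by simpa using hC N 0
  have hterm : ∀ n : ℕ, 1 ≤ n → ‖a n‖ * (n : ℝ) ^ (-s.re) ≤ 2 * C := by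
    intro n hn
    obtain ⟨m, rfl⟩ := Nat.exists_eq_add_of_le' hn
    have h := partialSum_succ a m s
    rw [← norm_natCast_cpow_neg hn, ← norm_mul, ← sub_eq_iff_eq_add'.2 h]
    exact (norm_sub_le _ _).trans (by linarith [hS (m + 1), hS m])
  have hsum : Summable fun n : ℕ => 2 * C * (Real.exp (4 * b) * (n : ℝ) ^ (-2 : ℝ)) :=
    ((Real.summable_nat_rpow.2 (by norm_num)).mul_left _).mul_left _
  refine ⟨∑' n : ℕ, 2 * C * (Real.exp (4 * b) * (n : ℝ) ^ (-2 : ℝ)), fun N u => ?_⟩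
  refine le_trans (norm_sum_le_of_le _ fun n hn => ?_)
    (sum_Icc_le_tsum hsum (fun n => by positivity) N)
  have hn1 := (Finset.mem_Icc.1 hn).1
  rw [norm_mul, norm_natCast_cpow_neg hn1, re_add_I_mul, damp, norm_mul, Complex.norm_real,
    Real.norm_of_nonneg (Real.exp_pos _).le]
  calc _ = (‖a n‖ * (n : ℝ) ^ (-s.re)) * Real.exp (-(Real.log n) ^ 2 / (4 * b)) := by ring
    _ ≤ _ := mul_le_mul (hterm n hn1) (exp_neg_log_sq_le hb hn1) (Real.exp_pos _).le
        (by positivity)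

lemma tendsto_partialSum_damp (a : ℕ → ℂ) (N : ℕ) (s : ℂ) :
    Tendsto (fun b : ℝ => partialSum (damp b a) N s) atTop (𝓝 (partialSum a N s)) := by
  refine tendsto_finsetSum _ fun n _ => Tendsto.mul_const _ ?_
  have h1 : Tendsto (fun b : ℝ => -(Real.log n) ^ 2 / (4 * b)) atTop (𝓝 0) :=
    tendsto_const_nhds.div_atTop (tendsto_id.const_mul_atTop (by norm_num))
  have h2 : Tendsto (fun b : ℝ => Real.exp (-(Real.log n) ^ 2 / (4 * b))) atTop (𝓝 1) := by
    have := (Real.continuous_exp.tendsto 0).comp h1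
    rwa [Real.exp_zero] at this
  have h3 : Tendsto (fun b : ℝ => a n * ((Real.exp (-(Real.log n) ^ 2 / (4 * b)) : ℝ) : ℂ))
      atTop (𝓝 (a n * ((1 : ℝ) : ℂ))) :=
    ((Complex.continuous_ofReal.tendsto 1).comp h2).const_mul (a n)
  simpa [damp] using h3

/-- **Bohr's inequality**: the `N`-th partial sum operator on `Hinf` has norm `O(N ^ η)`. -/
theorem exists_norm_partialSum_le_rpow {η : ℝ} (hη : 0 < η) (hη1 : η ≤ 1) :
    ∃ C, 0 ≤ C ∧ ∀ (f : Hinf) (a : ℕ → ℂ), IsCoeff f a → ∀ s : ℂ, 0 < s.re → ∀ N : ℕ,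
      ‖partialSum a N s‖ ≤ C * ‖f‖ * ((N + 1 : ℕ) : ℝ) ^ η := by
  obtain ⟨C, hC0, hC⟩ := exists_integral_norm_trapezoidKernel_le hη hη1
  refine ⟨C, hC0, fun f a ha s hs N => ?_⟩
  rcases Nat.eq_zero_or_pos N with rfl | hN
  · simp only [partialSum, Finset.Icc_eq_empty_of_lt zero_lt_one, Finset.sum_empty, norm_zero]
    positivity
  -- The estimate for damped coefficients is uniform in b, so it survives b → ∞.
  refine le_of_tendsto (tendsto_partialSum_damp a N s).norm ?_
  filter_upwards [eventually_gt_atTop 0] with b hb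
  have hre : ∀ u : ℝ, 0 < (s + Complex.I * u).re := fun u => by rwa [re_add_I_mul]
  choose F hFn hF using fun u : ℝ => ha.exists_damp hb (hre u)
  obtain ⟨B, hB⟩ := ha.exists_norm_partialSum_damp_le hb hs
  set p := Real.log N
  set q := Real.log (N + 1 : ℕ)
  have hN' : (1 : ℝ) ≤ N := by exact_mod_cast hN
  have hp : 0 ≤ p := Real.log_nonneg hN'
  have hpq : p < q := Real.log_lt_log (by linarith) (by push_cast; linarith)
  have hK := integrable_trapezoidKernel p q
  have hKn : Integrable fun u => B * ‖((trapezoidKernel p q u : ℝ) : ℂ)‖ :=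
    hK.ofReal.norm.const_mul B
  have hlim := tendsto_sum_mul_integral_exp hF hB hK.ofReal hKn
  -- No log n lies strictly between p and q, so the trapezoid acts as a sharp cut-off at N.
  have hev : ∀ᶠ M in atTop, ∑ n ∈ Finset.Icc 1 M, damp b a n * (n : ℂ) ^ (-s) *
      ∫ u : ℝ, Complex.exp (-(Complex.I * u * (Real.log n : ℝ))) * (trapezoidKernel p q u : ℂ) =
      partialSum (damp b a) N s := by
    filter_upwards [eventually_ge_atTop N] with M hM
    rw [partialSum, ← Finset.sum_subset (Finset.Icc_subset_Icc_right hM)]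
    · refine Finset.sum_congr rfl fun n hn => ?_
      obtain ⟨h1, h2⟩ := Finset.mem_Icc.1 hn
      rw [integral_trapezoidKernel_mul_exp, trapezoid_eq_one hpq
        (Real.log_natCast_nonneg n) (Real.log_le_log (by exact_mod_cast h1) (by exact_mod_cast h2)),
        Complex.ofReal_one, mul_one]
    · intro n hn hn'
      have h1 := (Finset.mem_Icc.1 hn).1
      have h2 : N + 1 ≤ n := by
        by_contra h
        exact hn' (Finset.mem_Icc.2 ⟨h1, by omega⟩)
      rw [integral_trapezoidKernel_mul_exp, trapezoid_eq_zero hp hpq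
        (Real.log_le_log (by positivity) (by exact_mod_cast h2)), Complex.ofReal_zero, mul_zero]
  rw [tendsto_nhds_unique_of_eventuallyEq tendsto_const_nhds hlim
    (hev.mono fun _ h => h.symm)]
  calc _ ≤ ‖f‖ * ∫ u, ‖((trapezoidKernel p q u : ℝ) : ℂ)‖ := norm_integral_mul_le hFn hK.ofReal
    _ ≤ ‖f‖ * (C * ((N + 1 : ℕ) : ℝ) ^ η) := by
        gcongr
        simpa only [Complex.norm_real] using hC N hN
    _ = _ := by ring

/-- Uniform convergence of the Dirichlet series of bounded families on smaller half-planes. -/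
theorem exists_norm_valueAt_sub_partialSum_le {ε : ℝ} (hε : 0 < ε) :
    ∃ τ : ℕ → ℝ, Tendsto τ atTop (𝓝 0) ∧ ∀ (f : Hinf) (a : ℕ → ℂ), IsCoeff f a →
      ∀ s : RightHalfPlane, ε < (s : ℂ).re → ∀ N,
        ‖valueAt f s - partialSum a N s‖ ≤ τ N * ‖f‖ := by
  set η := min (ε / 2) 1
  have hη : 0 < η := by positivity
  obtain ⟨C, hC0, hC⟩ := exists_norm_partialSum_le_rpow hη (min_le_right _ _)
  obtain ⟨τ, hτ, h⟩ := exists_tendsto_zero_norm_sub_partialSum_le hη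
    (lt_of_le_of_lt (min_le_left _ _) (by linarith : ε / 2 < ε))
  refine ⟨fun N => τ N * C, by simpa using hτ.mul_const C, fun f a ha s hs N => ?_⟩
  -- Bohr's inequality holds at s - ε, which still has positive real part.
  have := h a (s - ε) (valueAt f s) (C * ‖f‖) (by positivity)
    (hC f a ha _ (by simpa using hs)) (by simpa using ha s) N
  simpa [mul_assoc] using this

/-! ### Coefficient functionals, completeness and compactness -/

lemma exists_valueAt_eq {g : RightHalfPlane → ℂ} {a : ℕ → ℂ} {M : ℝ} (hM : ∀ s, ‖g s‖ ≤ M)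
    (h : ∀ s : RightHalfPlane, DirichletSeriesConvergesTo a s (g s)) :
    ∃ f : Hinf, ∀ s, valueAt f s = g s :=
  ⟨⟨⟨g, memℓp_infty_iff.2 ⟨M, by rintro _ ⟨s, rfl⟩; exact hM s⟩⟩, a, h⟩, fun _ => rfl⟩

lemma norm_le_of_forall_norm_valueAt_le {f : Hinf} {C : ℝ} (hC : 0 ≤ C)
    (h : ∀ s, ‖valueAt f s‖ ≤ C) : ‖f‖ ≤ C :=
  lp.norm_le_of_forall_le hC h

lemma valueAt_add (f g : Hinf) (s : RightHalfPlane) :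
    valueAt (f + g) s = valueAt f s + valueAt g s := rfl

lemma valueAt_sub (f g : Hinf) (s : RightHalfPlane) :
    valueAt (f - g) s = valueAt f s - valueAt g s := rfl

lemma valueAt_smul (c : ℂ) (f : Hinf) (s : RightHalfPlane) :
    valueAt (c • f) s = c * valueAt f s := rfl

/-- Evaluation at a point of the half-plane as a linear functional. -/
def valueAtₗ (s : RightHalfPlane) : Hinf →ₗ[ℂ] ℂ where
  toFun f := valueAt f s
  map_add' f g := valueAt_add f g s
  map_smul' c f := valueAt_smul c f s

lemma IsCoeff.add {f g : Hinf} {a b : ℕ → ℂ} (ha : IsCoeff f a) (hb : IsCoeff g b) :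
    IsCoeff (f + g) (a + b) := fun s => by
  have h := (ha s).add (hb s)
  simp only [← Finset.sum_add_distrib, ← add_mul] at h
  exact h

lemma IsCoeff.smul {f : Hinf} {a : ℕ → ℂ} (c : ℂ) (ha : IsCoeff f a) :
    IsCoeff (c • f) (c • a) := fun s => by
  have h := (ha s).const_mul c
  simp only [Finset.mul_sum, ← mul_assoc] at h
  exact h

/-- Difference of consecutive partial sums at s = 1, with η = 1 in Bohr's inequality. -/
lemma exists_norm_coeff_le : ∃ B : ℕ → ℝ, ∀ (f : Hinf) (a : ℕ → ℂ), IsCoeff f a →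
    ∀ n, 1 ≤ n → ‖a n‖ ≤ B n * ‖f‖ := by
  obtain ⟨C, hC0, hC⟩ := exists_norm_partialSum_le_rpow one_pos le_rfl
  refine ⟨fun n => 2 * C * (n + 1) * n, fun f a ha n hn => ?_⟩
  obtain ⟨m, rfl⟩ := Nat.exists_eq_add_of_le' hn
  have h := partialSum_succ a m 1
  have h1 := hC f a ha 1 (by simp) (m + 1)
  have h2 := hC f a ha 1 (by simp) m
  rw [Real.rpow_one] at h1 h2
  have h3 : ‖a (m + 1)‖ * (((m + 1 : ℕ) : ℝ))⁻¹ ≤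
      C * ‖f‖ * ((m + 1 + 1 : ℕ) : ℝ) + C * ‖f‖ * ((m + 1 : ℕ) : ℝ) := by
    rw [← Real.rpow_neg_one, ← Complex.one_re, ← norm_natCast_cpow_neg hn, ← norm_mul,
      ← sub_eq_iff_eq_add'.2 h]
    exact (norm_sub_le _ _).trans (add_le_add h1 h2)
  have hm : (0 : ℝ) < ((m + 1 : ℕ) : ℝ) := by positivity
  rw [← div_eq_mul_inv, div_le_iff₀ hm] at h3
  refine h3.trans ?_
  push_cast
  have : 0 ≤ C * ‖f‖ * (m + 1) := by positivity
  nlinarith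

/-- The sequence a - b represents 0, so the coefficient bound kills it. -/
lemma IsCoeff.eq {f : Hinf} {a b : ℕ → ℂ} (ha : IsCoeff f a) (hb : IsCoeff f b) {n : ℕ}
    (hn : 1 ≤ n) : a n = b n := by
  obtain ⟨B, hB⟩ := exists_norm_coeff_le
  have h := hB _ _ (ha.add (hb.smul (-1))) n hn
  rw [show f + (-1 : ℂ) • f = 0 by rw [neg_one_smul, add_neg_cancel], norm_zero, mul_zero, norm_le_zero_iff] at h
  simpa [← sub_eq_add_neg, sub_eq_zero] using h

/-- The `n`-th Dirichlet coefficient, for `n ≥ 1`, as a linear functional on `Hinf`. -/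
def coeffₗ (n : ℕ) (hn : 1 ≤ n) : Hinf →ₗ[ℂ] ℂ where
  toFun f := (exists_isCoeff f).choose n
  map_add' f g := (exists_isCoeff (f + g)).choose_spec.eq
    ((exists_isCoeff f).choose_spec.add (exists_isCoeff g).choose_spec) hn
  map_smul' c f := (exists_isCoeff (c • f)).choose_spec.eq
    ((exists_isCoeff f).choose_spec.smul c) hn

/-- The `n`-th Dirichlet coefficient as a bounded linear functional on `Hinf`
(zero for `n = 0`). -/
def coeff (n : ℕ) : Hinf →L[ℂ] ℂ :=
  if hn : 1 ≤ n then
    (coeffₗ n hn).mkContinuous (exists_norm_coeff_le.choose n) fun f =>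
      exists_norm_coeff_le.choose_spec f _ (exists_isCoeff f).choose_spec n hn
  else 0

lemma isCoeff_coeff (f : Hinf) : IsCoeff f fun n => coeff n f := fun s => by
  refine ((exists_isCoeff f).choose_spec s).congr fun N => Finset.sum_congr rfl fun n hn => ?_
  have hn1 := (Finset.mem_Icc.1 hn).1
  simp only [coeff, hn1, dif_pos]
  rfl

/-- Coefficients converge because the functionals are bounded, and the common rate τ passes to the
limit, so the limit series sums to the limit function. -/
lemma isClosed_Hinf : IsClosed (Hinf : Set (lp (fun _ : RightHalfPlane => ℂ) ∞)) := by
  refine isClosed_of_closure_subset fun g hg => ?_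
  obtain ⟨x, hx, hlim⟩ := mem_closure_iff_seq_limit.1 hg
  set f : ℕ → Hinf := fun k => ⟨x k, hx k⟩
  have hcauchy : CauchySeq f := by
    have h := Metric.cauchySeq_iff.1 hlim.cauchySeq
    exact Metric.cauchySeq_iff.2 h
  have hc : ∀ n, ∃ z, Tendsto (fun k => coeff n (f k)) atTop (𝓝 z) := fun n =>
    cauchySeq_tendsto_of_complete (hcauchy.map (coeff n).uniformContinuous)
  choose a ha using hc
  have hval : ∀ s : RightHalfPlane, Tendsto (fun k => valueAt (f k) s) atTop (𝓝 (g s)) := by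
    intro s
    rw [tendsto_iff_norm_sub_tendsto_zero] at hlim ⊢
    exact squeeze_zero (fun _ => norm_nonneg _)
      (fun k => lp.norm_apply_le_norm ENNReal.top_ne_zero (x k - g) s) hlim
  have hnorm : Tendsto (fun k => ‖f k‖) atTop (𝓝 ‖g‖) := hlim.norm
  refine ⟨a, fun s => ?_⟩
  obtain ⟨τ, hτ, h⟩ := exists_norm_valueAt_sub_partialSum_le (ε := (s : ℂ).re / 2)
    (half_pos s.2)
  have hb : ∀ N, ‖g s - partialSum a N s‖ ≤ τ N * ‖g‖ := by
    intro N
    refine le_of_tendsto_of_tendsto (((hval s).sub (f := fun k => valueAt (f k) s)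
      (g := fun k => partialSum (fun n => coeff n (f k)) N s) ?_).norm) (hnorm.const_mul (τ N))
      (Eventually.of_forall fun k => h (f k) _ (isCoeff_coeff (f k)) s (half_lt_self s.2) N)
    exact tendsto_finsetSum _ fun n _ => (ha n).mul_const _
  have : Tendsto (fun N => ‖partialSum a N s - g s‖) atTop (𝓝 0) := by
    refine squeeze_zero (fun _ => norm_nonneg _) (fun N => ?_)
      (by simpa using hτ.mul_const ‖g‖)
    rw [norm_sub_rev]
    exact hb N
  exact tendsto_iff_norm_sub_tendsto_zero.2 this

instance : CompleteSpace Hinf := isClosed_Hinf.completeSpace_coe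

lemma exists_valueAt_eq_cpow {n : ℕ} (hn : 1 ≤ n) :
    ∃ f : Hinf, ∀ s, valueAt f s = (n : ℂ) ^ (-(s : ℂ)) := by
  refine exists_valueAt_eq (a := Pi.single n 1) (M := 1) (fun s => ?_) (fun s => ?_)
  · rw [norm_natCast_cpow_neg hn]
    exact Real.rpow_le_one_of_one_le_of_nonpos (by exact_mod_cast hn)
      (neg_nonpos.2 (le_of_lt s.2))
  · refine tendsto_const_nhds.congr' ?_
    filter_upwards [eventually_ge_atTop n] with N hN
    rw [Finset.sum_eq_single n]
    · simp
    · intro m _ hm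
      simp [hm]
    · intro h
      exact absurd (Finset.mem_Icc.2 ⟨hn, hN⟩) h

/-- The function `s ↦ n ^ (-s)` as an element of `Hinf` (zero for `n = 0`). -/
def monomial (n : ℕ) : Hinf :=
  if hn : 1 ≤ n then (exists_valueAt_eq_cpow hn).choose else 0

lemma valueAt_monomial {n : ℕ} (hn : 1 ≤ n) (s : RightHalfPlane) :
    valueAt (monomial n) s = (n : ℂ) ^ (-(s : ℂ)) := by
  rw [monomial, dif_pos hn]
  exact (exists_valueAt_eq_cpow hn).choose_spec s

section Operators

variable {X Y : Type*} [NormedAddCommGroup X] [NormedSpace ℂ X]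
  [NormedAddCommGroup Y] [NormedSpace ℂ Y]

lemma isCompactOperator_smulRight (φ : X →L[ℂ] ℂ) (y : Y) :
    IsCompactOperator (φ.smulRight y) := by
  refine ⟨(fun c : ℂ => c • y) '' Metric.closedBall 0 1,
    (isCompact_closedBall 0 1).image (by fun_prop), ?_⟩
  have h : φ ⁻¹' Metric.closedBall 0 1 ∈ 𝓝 0 :=
    φ.continuous.continuousAt.preimage_mem_nhds
      (by rw [map_zero]; exact Metric.closedBall_mem_nhds 0 one_pos)
  filter_upwards [h] with x hx
  exact ⟨φ x, hx, rfl⟩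

lemma isCompactOperator_sum_smulRight {ι : Type*} (t : Finset ι) (φ : ι → X →L[ℂ] ℂ)
    (y : ι → Y) : IsCompactOperator ⇑(∑ i ∈ t, (φ i).smulRight (y i)) := by
  classical
  induction t using Finset.induction_on with
  | empty => simpa using isCompactOperator_zero
  | insert i t hi ih =>
    rw [Finset.sum_insert hi]
    exact (isCompactOperator_smulRight _ _).add ih

lemma isCompactOperator_of_norm_sub_sum_le [CompleteSpace Y] {T : X →L[ℂ] Y}
    (φ : ℕ → X →L[ℂ] ℂ) (y : ℕ → Y) {τ : ℕ → ℝ} (hτ : Tendsto τ atTop (𝓝 0))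
    (h : ∀ N x, ‖T x - ∑ n ∈ Finset.Icc 1 N, φ n x • y n‖ ≤ τ N * ‖x‖) :
    IsCompactOperator T := by
  have hlim : Tendsto (fun N => ∑ n ∈ Finset.Icc 1 N, (φ n).smulRight (y n)) atTop (𝓝 T) := by
    rw [tendsto_iff_norm_sub_tendsto_zero]
    refine squeeze_zero (fun _ => norm_nonneg _) (fun N => ?_) (by simpa using hτ.abs)
    refine ContinuousLinearMap.opNorm_le_bound _ (abs_nonneg _) fun x => ?_
    rw [sub_apply, norm_sub_rev, sum_apply]
    exact (h N x).trans (by gcongr; exact le_abs_self _)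
  exact isCompactOperator_of_tendsto hlim
    (Eventually.of_forall fun N => isCompactOperator_sum_smulRight _ _ _)

end Operators

/-- The composition sees f only on Re s > ε, where partial sums converge uniformly over the unit
ball; composing them with Φ gives finite-rank approximations. -/
theorem isCompactOperator_of_subset_halfPlane {Φ : RightHalfPlane → RightHalfPlane}
    {T : Hinf →L[ℂ] Hinf} (hT : IsCompositionOperator Φ T) {ε : ℝ} (hε : 0 < ε)
    (hΦ : ∀ s, (Φ s : ℂ) ∈ halfPlane ε) : IsCompactOperator T := by
  obtain ⟨τ, hτ, h⟩ := exists_norm_valueAt_sub_partialSum_le hε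
  refine isCompactOperator_of_norm_sub_sum_le coeff (fun n => T (monomial n)) hτ fun N f => ?_
  have hτ0 : 0 ≤ τ N * ‖f‖ :=
    (norm_nonneg _).trans (h f _ (isCoeff_coeff f) (Φ ⟨1, by simp [mem_halfPlane]⟩) (hΦ _) N)
  refine norm_le_of_forall_norm_valueAt_le hτ0 fun s => ?_
  have hS : valueAt (∑ n ∈ Finset.Icc 1 N, coeff n f • T (monomial n)) s =
      partialSum (fun n => coeff n f) N (Φ s) := by
    change valueAtₗ s _ = _
    simp only [map_sum, map_smul, partialSum]
    refine Finset.sum_congr rfl fun n hn => ?_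
    rw [smul_eq_mul]
    congr 1
    exact (hT _ _).trans (valueAt_monomial (Finset.mem_Icc.1 hn).1 _)
  rw [valueAt_sub, hS, hT]
  exact h f _ (isCoeff_coeff f) (Φ s) (hΦ s) N

/-! ### Weak compactness -/

section Operators

variable {X Y : Type*} [NormedAddCommGroup X] [NormedSpace ℂ X]
  [NormedAddCommGroup Y] [NormedSpace ℂ Y]

lemma isWeaklyCompactOperator_of_isCompactOperator {T : X →L[ℂ] Y} (hT : IsCompactOperator T) :
    IsWeaklyCompactOperator T := by
  have h := (hT.isCompact_closure_image_closedBall (f := (T : X →ₗ[ℂ] Y)) 1).image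
    (toWeakSpaceCLM ℂ Y).continuous
  exact h.of_isClosed_subset isClosed_closure
    (closure_minimal (Set.image_mono subset_closure) h.isClosed)

/-- The indicator of `{0, …, N - 1}` in `ℓ^∞`. -/
def initialIndicator (N : ℕ) : EllInf :=
  ⟨fun k => if k < N then 1 else 0, memℓp_infty_iff.2 ⟨1, by
    rintro _ ⟨k, rfl⟩
    dsimp only
    split_ifs <;> simp⟩⟩

lemma initialIndicator_apply (N k : ℕ) :
    (initialIndicator N) k = if k < N then (1 : ℂ) else 0 := rfl

lemma norm_initialIndicator_le (N : ℕ) : ‖initialIndicator N‖ ≤ 1 :=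
  lp.norm_le_of_forall_le zero_le_one fun k => by
    rw [initialIndicator_apply]
    split_ifs <;> simp

/-- The finitely supported sequences, as a subspace of `ℓ^∞`. -/
def finSupport : Submodule ℂ EllInf where
  carrier := {x | ∀ᶠ k in atTop, x k = 0}
  zero_mem' := by simp
  add_mem' := by
    intro x y hx hy
    filter_upwards [hx, hy] with k h1 h2
    simp [h1, h2]
  smul_mem' := by
    intro c x hx
    filter_upwards [hx] with k h1
    simp [h1]

lemma initialIndicator_mem_finSupport (N : ℕ) : initialIndicator N ∈ finSupport := by
  filter_upwards [eventually_ge_atTop N] with k hk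
  rw [initialIndicator_apply, if_neg (by omega)]

/-- The `k`-th coordinate functional on `ℓ^∞`. -/
def coordinate (k : ℕ) : EllInf →ₗ[ℂ] ℂ where
  toFun x := x k
  map_add' _ _ := rfl
  map_smul' _ _ := rfl

lemma coordinate_apply (k : ℕ) (x : EllInf) : coordinate k x = x k := rfl

/-- Mazur's theorem puts a weak cluster point of the images of the rescaled initial indicators in
the norm closure of the images of finitely supported sequences. Every extended coordinate of it
equals r⁻¹, whereas each finitely supported sequence has a zero coordinate. -/
lemma not_isWeaklyCompactOperator_of_fixesCopyOf {T : X →L[ℂ] Y}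
    (h : FixesCopyOf EllInf T) : ¬ IsWeaklyCompactOperator T := by
  intro hT
  obtain ⟨W, J, φ, hJ⟩ : ∃ (W : Submodule ℂ Y) (J : EllInf ≃L[ℂ] W) (φ : EllInf →L[ℂ] X),
      ∀ x, (J x : Y) = T (φ x) := by
    obtain ⟨Z, ⟨φ⟩, e, he⟩ := h
    exact ⟨_, φ.symm.trans e, Z.subtypeL.comp (φ.symm : EllInf →L[ℂ] Z), fun x => he (φ.symm x)⟩
  -- the coordinate functionals, extended to `Y` with a common bound
  have hψ : ∀ k, ∃ ψ : Y →L[ℂ] ℂ, (∀ x : EllInf, ψ (J x) = x k) ∧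
      ‖ψ‖ ≤ ‖(J.symm : W →L[ℂ] EllInf)‖ := by
    intro k
    obtain ⟨g, hg1, hg2⟩ := exists_extension_norm_eq W
      (((coordinate k).comp (J.symm : W →L[ℂ] EllInf).toLinearMap).mkContinuous
        ‖(J.symm : W →L[ℂ] EllInf)‖ fun w =>
          (lp.norm_apply_le_norm ENNReal.top_ne_zero (J.symm w) k).trans
            ((J.symm : W →L[ℂ] EllInf).le_opNorm w))
    refine ⟨g, fun x => ?_, ?_⟩
    · rw [hg1]
      simp [coordinate_apply]
    · rw [hg2]
      exact LinearMap.mkContinuous_norm_le _ (norm_nonneg (J.symm : W →L[ℂ] EllInf)) _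
  choose ψ hψ1 hψ2 using hψ
  set B := ‖(J.symm : W →L[ℂ] EllInf)‖
  -- a scalar bringing the test sequence into the unit ball
  set r : ℝ := ‖φ‖ + 1
  have hr : 0 < r := by positivity
  set y : ℕ → Y := fun N => J ((r⁻¹ : ℂ) • initialIndicator N) with hy
  have hball : ∀ N, toWeakSpace ℂ Y (y N) ∈
      closure (toWeakSpace ℂ Y '' (T '' Metric.closedBall (0 : X) 1)) := by
    intro N
    refine subset_closure ⟨_, ⟨φ ((r⁻¹ : ℂ) • initialIndicator N), ?_, rfl⟩, ?_⟩
    · rw [mem_closedBall_zero_iff]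
      have h1 := φ.le_opNorm ((r⁻¹ : ℂ) • initialIndicator N)
      have h2 : ‖(r⁻¹ : ℂ) • initialIndicator N‖ ≤ r⁻¹ := by
        rw [norm_smul, norm_inv, Complex.norm_real, Real.norm_of_nonneg hr.le]
        have := norm_initialIndicator_le N
        exact mul_le_of_le_one_right (by positivity) this
      calc _ ≤ ‖φ‖ * r⁻¹ := h1.trans (by gcongr)
        _ ≤ r * r⁻¹ := by gcongr; simp [r]
        _ = 1 := mul_inv_cancel₀ hr.ne'
    · rw [← hJ]
  obtain ⟨z, -, hz⟩ := hT.exists_mapClusterPt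
    (f := atTop) (u := fun N => toWeakSpace ℂ Y (y N))
    (tendsto_principal.2 (Eventually.of_forall hball))
  obtain ⟨y₀, rfl⟩ := (toWeakSpace ℂ Y).surjective z
  -- the cluster point is a norm limit of images of finitely supported sequences
  set V : Submodule ℂ Y := (finSupport.map (J : EllInf →ₗ[ℂ] W)).map W.subtype
  have hyV : ∀ N, y N ∈ V := fun N =>
    ⟨J ((r⁻¹ : ℂ) • initialIndicator N), ⟨_, finSupport.smul_mem _
      (initialIndicator_mem_finSupport N), rfl⟩, rfl⟩
  have hcl : y₀ ∈ closure (V : Set Y) := by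
    have h1 : toWeakSpace ℂ Y y₀ ∈ closure (toWeakSpace ℂ Y '' (V : Set Y)) := by
      exact mem_closure_iff_clusterPt.2 (ClusterPt.mono hz (tendsto_principal.2
        (Eventually.of_forall fun N => ⟨y N, hyV N, rfl⟩)))
    have hconv : Convex ℝ (V : Set Y) := (V.restrictScalars ℝ).convex
    rw [← Convex.toWeakSpace_closure ℂ hconv] at h1
    obtain ⟨v, hv, hvy⟩ := h1
    rwa [(toWeakSpace ℂ Y).injective hvy] at hv
  have hval : ∀ k, ψ k y₀ = (r⁻¹ : ℂ) := by
    intro k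
    have hcont : Continuous fun x : WeakSpace ℂ Y => ψ k ((toWeakSpace ℂ Y).symm x) :=
      WeakBilin.eval_continuous (topDualPairing ℂ Y).flip (ψ k)
    have h1 := hz.continuousAt_comp (f := fun x => ψ k ((toWeakSpace ℂ Y).symm x))
      hcont.continuousAt
    have h2 : Tendsto (fun N => ψ k (y N)) atTop (𝓝 (r⁻¹ : ℂ)) := by
      refine tendsto_const_nhds.congr' ?_
      filter_upwards [eventually_gt_atTop k] with N hN
      rw [hy, hψ1]
      change _ = (r⁻¹ : ℂ) * initialIndicator N k
      rw [initialIndicator_apply, if_pos hN, mul_one]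
    exact eq_of_nhds_neBot (ClusterPt.mono h1 h2)
  -- All ψ k have norm at most B, so at this distance coordinates differ by less than r⁻¹; B + 1
  -- avoids dividing by zero.
  obtain ⟨v, hv, hvd⟩ := Metric.mem_closure_iff.1 hcl (r⁻¹ / (B + 1)) (by positivity)
  obtain ⟨_, ⟨x, hx, rfl⟩, rfl⟩ := hv
  obtain ⟨k, hk⟩ := Eventually.exists (f := atTop) hx
  have h1 : ψ k (y₀ - (J x : Y)) = (r⁻¹ : ℂ) := by
    rw [map_sub, hval, hψ1, hk, sub_zero]
  have h2 := (ψ k).le_opNorm (y₀ - (J x : Y))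
  rw [h1, norm_inv, Complex.norm_real, Real.norm_of_nonneg hr.le] at h2
  rw [dist_eq_norm] at hvd
  have h3 : r⁻¹ < r⁻¹ := by
    calc r⁻¹ ≤ B * ‖y₀ - (J x : Y)‖ := h2.trans (by gcongr; exact hψ2 k)
      _ ≤ (B + 1) * ‖y₀ - (J x : Y)‖ := by gcongr; linarith
      _ < (B + 1) * (r⁻¹ / (B + 1)) := by
          have : 0 < B + 1 := by positivity
          gcongr
          exact hvd
      _ = r⁻¹ := by
          have : B + 1 ≠ 0 := by positivity
          field_simp
  exact lt_irrefl _ h3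

end Operators

/-! ### Interpolation by bounded holomorphic functions in the disc -/

lemma two_pow_cpow (k : ℕ) (w : ℂ) : ((2 ^ k : ℕ) : ℂ) ^ w = ((2 : ℂ) ^ w) ^ k := by
  induction k with
  | zero => simp
  | succ k ih =>
    rw [pow_succ, Nat.cast_mul, Complex.natCast_mul_natCast_cpow, ih, pow_succ, Nat.cast_two]

lemma sum_range_succ_eq_sum_Icc {F : ℕ → ℂ} (h0 : F 0 = 0) (N : ℕ) :
    ∑ n ∈ Finset.range (N + 1), F n = ∑ n ∈ Finset.Icc 1 N, F n := by
  induction N with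
  | zero => simp [h0]
  | succ N ih => rw [Finset.sum_range_succ, ih, Finset.sum_Icc_succ_top (by omega)]

/-- Power series in `2 ^ (-s)`: a bounded holomorphic function on the unit disc gives an element
of `Hinf`. -/
lemma exists_valueAt_eq_comp_two_cpow {g : ℂ → ℂ} (hg : DifferentiableOn ℂ g (Metric.ball 0 1))
    {M : ℝ} (hM : ∀ z ∈ Metric.ball (0 : ℂ) 1, ‖g z‖ ≤ M) :
    ∃ f : Hinf, ∀ s : RightHalfPlane, valueAt f s = g ((2 : ℂ) ^ (-(s : ℂ))) := by
  have hball : ∀ s : RightHalfPlane, (2 : ℂ) ^ (-(s : ℂ)) ∈ Metric.ball (0 : ℂ) 1 := by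
    intro s
    have h := norm_natCast_cpow_neg (n := 2) (by norm_num) (s : ℂ)
    rw [mem_ball_zero_iff]
    push_cast at h
    rw [h]
    exact Real.rpow_lt_one_of_one_lt_of_neg (by norm_num) (neg_lt_zero.2 s.2)
  set c : ℕ → ℂ := fun n => ((n.factorial : ℂ))⁻¹ * iteratedDeriv n g 0
  -- Taylor coefficients sit at the indices 2 ^ k, with zeros elsewhere.
  refine exists_valueAt_eq (a := Function.extend (fun k : ℕ => 2 ^ k) c 0)
    (fun s => hM _ (hball s)) (fun s => ?_)
  have hinj : Function.Injective (fun k : ℕ => 2 ^ k) := Nat.pow_right_injective le_rfl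
  have h1 := Complex.hasSum_taylorSeries_on_ball hg (hball s)
  have h2 : HasSum (fun n : ℕ => Function.extend (fun k : ℕ => 2 ^ k) c 0 n *
      (n : ℂ) ^ (-(s : ℂ))) (g ((2 : ℂ) ^ (-(s : ℂ)))) := by
    rw [← hinj.hasSum_iff]
    · have e : (fun n : ℕ => Function.extend (fun k : ℕ => 2 ^ k) c 0 n *
          (n : ℂ) ^ (-(s : ℂ))) ∘ (fun k : ℕ => 2 ^ k) = fun n =>
          ((n.factorial : ℂ))⁻¹ • ((2 : ℂ) ^ (-(s : ℂ)) - 0) ^ n • iteratedDeriv n g 0 := by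
        ext k
        rw [Function.comp_apply, hinj.extend_apply, two_pow_cpow, sub_zero, smul_eq_mul,
          smul_eq_mul]
        ring
      rw [e]
      exact h1
    · intro n hn
      rw [Function.extend_apply' _ _ _ (by simpa using hn)]
      simp
  have h3 := h2.tendsto_sum_nat.comp (tendsto_add_atTop_nat 1)
  refine h3.congr fun N => ?_
  have h0 : Function.extend (fun k : ℕ => 2 ^ k) c 0 0 = 0 := by
    rw [Function.extend_apply' _ _ _ (by simp)]
    rfl
  exact sum_range_succ_eq_sum_Icc (by rw [h0, zero_mul]) N

/-- A function on the disc peaking at `w` and vanishing at `ζ`. -/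
def peak (ζ w z : ℂ) : ℂ :=
  (1 - ‖w‖ ^ 2) / (1 - starRingEnd ℂ w * z) * ((ζ - z) / (ζ * (1 + ‖ζ - w‖) - z))

section Peak

variable {ζ w z : ℂ}

lemma one_sub_norm_le (hz : ‖z‖ < 1) : 1 - ‖w‖ ≤ ‖1 - starRingEnd ℂ w * z‖ := by
  have h1 := norm_sub_norm_le (1 : ℂ) (starRingEnd ℂ w * z)
  rw [norm_one, norm_mul, Complex.norm_conj] at h1
  nlinarith [norm_nonneg w, norm_nonneg z]

lemma norm_le_norm_sub (hζ : ‖ζ‖ = 1) (hz : ‖z‖ < 1) :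
    ‖ζ - w‖ ≤ ‖ζ * (1 + ‖ζ - w‖) - z‖ := by
  have h1 := norm_sub_norm_le (ζ * (1 + ‖ζ - w‖)) z
  have h2 : ‖(1 + ‖ζ - w‖ : ℂ)‖ = 1 + ‖ζ - w‖ := by
    rw [← Complex.ofReal_one, ← Complex.ofReal_add, Complex.norm_real,
      Real.norm_of_nonneg (by positivity)]
  rw [norm_mul, hζ, h2] at h1
  linarith

/-- The squares differ by 2δ(1 - Re(conj ζ · z)) + δ², which is nonnegative. -/
lemma norm_sub_le_norm_sub (hζ : ‖ζ‖ = 1) (hz : ‖z‖ < 1) {δ : ℝ} (hδ : 0 ≤ δ) :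
    ‖ζ - z‖ ≤ ‖ζ * (1 + δ) - z‖ := by
  refine le_of_sq_le_sq ?_ (norm_nonneg _)
  have hs : ζ.re ^ 2 + ζ.im ^ 2 = 1 := by
    have := Complex.sq_norm ζ
    rw [hζ, Complex.normSq_apply] at this
    nlinarith
  have hz2 : z.re ^ 2 + z.im ^ 2 < 1 := by
    have := Complex.sq_norm z
    rw [Complex.normSq_apply] at this
    nlinarith [norm_nonneg z]
  have hin : ζ.re * z.re + ζ.im * z.im ≤ 1 := by
    nlinarith [sq_nonneg (ζ.re - z.re), sq_nonneg (ζ.im - z.im)]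
  rw [Complex.sq_norm, Complex.sq_norm, Complex.normSq_apply, Complex.normSq_apply]
  simp only [Complex.sub_re, Complex.sub_im, Complex.mul_re, Complex.mul_im, Complex.add_re,
    Complex.add_im, Complex.one_re, Complex.one_im, Complex.ofReal_re, Complex.ofReal_im]
  nlinarith [mul_nonneg hδ (sub_nonneg.2 hin), sq_nonneg δ]

lemma norm_one_sub_sq (hw : ‖w‖ < 1) : ‖(1 - ‖w‖ ^ 2 : ℂ)‖ = 1 - ‖w‖ ^ 2 := by
  rw [← Complex.ofReal_one, ← Complex.ofReal_pow, ← Complex.ofReal_sub, Complex.norm_real,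
    Real.norm_of_nonneg (by nlinarith [norm_nonneg w])]

lemma norm_sub_pos (hζ : ‖ζ‖ = 1) (hw : ‖w‖ < 1) : 0 < ‖ζ - w‖ := by
  rw [norm_sub_pos_iff]
  rintro rfl
  linarith

lemma norm_peak_left_le (hw : ‖w‖ < 1) (hz : ‖z‖ < 1) :
    ‖(1 - ‖w‖ ^ 2 : ℂ) / (1 - starRingEnd ℂ w * z)‖ ≤ 2 := by
  have h := one_sub_norm_le (w := w) hz
  have hw' : 0 < 1 - ‖w‖ := by linarith
  rw [norm_div, norm_one_sub_sq hw, div_le_iff₀ (by linarith)]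
  nlinarith [norm_nonneg w]

lemma norm_peak_right_le (hζ : ‖ζ‖ = 1) (hz : ‖z‖ < 1) :
    ‖(ζ - z) / (ζ * (1 + ‖ζ - w‖) - z)‖ ≤ 1 := by
  rw [norm_div]
  exact div_le_one_of_le₀ (norm_sub_le_norm_sub hζ hz (norm_nonneg _)) (norm_nonneg _)

lemma norm_peak_le (hζ : ‖ζ‖ = 1) (hw : ‖w‖ < 1) (hz : ‖z‖ < 1) : ‖peak ζ w z‖ ≤ 2 := by
  rw [peak, norm_mul]
  calc _ ≤ 2 * 1 := mul_le_mul (norm_peak_left_le hw hz) (norm_peak_right_le hζ hz)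
        (norm_nonneg _) (by norm_num)
    _ = 2 := by norm_num

/-- At w the first factor is 1, and shifting the pole by exactly ‖ζ - w‖ at most doubles the
denominator of the second. -/
lemma half_le_norm_peak_self (hζ : ‖ζ‖ = 1) (hw : ‖w‖ < 1) : 1 / 2 ≤ ‖peak ζ w w‖ := by
  have hd := norm_sub_pos hζ hw
  have h1 : (1 - ‖w‖ ^ 2 : ℂ) / (1 - starRingEnd ℂ w * w) = 1 := by
    rw [← Complex.normSq_eq_conj_mul_self, Complex.normSq_eq_norm_sq, Complex.ofReal_pow]
    refine div_self fun h => ?_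
    have := norm_one_sub_sq hw
    rw [h, norm_zero] at this
    nlinarith [norm_nonneg w]
  rw [peak, h1, one_mul, norm_div]
  have h2 : ‖ζ * (1 + ‖ζ - w‖) - w‖ ≤ 2 * ‖ζ - w‖ := by
    rw [show ζ * (1 + ‖ζ - w‖) - w = (ζ - w) + ζ * ‖ζ - w‖ by ring]
    refine (norm_add_le _ _).trans ?_
    rw [norm_mul, hζ, Complex.norm_real, norm_norm]
    linarith
  have h3 := norm_le_norm_sub (w := w) hζ hw
  rw [div_le_div_iff₀ (by norm_num) (by linarith)]
  linarith

lemma norm_peak_le_near (hζ : ‖ζ‖ = 1) (hw : ‖w‖ < 1) (hz : ‖z‖ < 1) :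
    ‖peak ζ w z‖ ≤ 2 * (‖ζ - z‖ / ‖ζ - w‖) := by
  have hd := norm_sub_pos hζ hw
  rw [peak, norm_mul]
  refine mul_le_mul (norm_peak_left_le hw hz) ?_ (norm_nonneg _) (by norm_num)
  rw [norm_div]
  gcongr
  exact norm_le_norm_sub hζ hz

/-- The first factor is small: its numerator vanishes as |w| → 1, while its denominator is at least
|ζ - z| - |w - ζ|. -/
lemma norm_peak_le_away (hζ : ‖ζ‖ = 1) (hw : ‖w‖ < 1) (hz : ‖z‖ < 1) {η : ℝ}
    (hη : η ≤ ‖ζ - z‖) (hwη : ‖w - ζ‖ < η) : ‖peak ζ w z‖ ≤ (1 - ‖w‖ ^ 2) / (η - ‖w - ζ‖) := by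
  have h0 : 0 ≤ 1 - ‖w‖ ^ 2 := by nlinarith [norm_nonneg w]
  have h1 : η - ‖w - ζ‖ ≤ ‖1 - starRingEnd ℂ w * z‖ := by
    have hζζ : starRingEnd ℂ ζ * ζ = 1 := by
      rw [← Complex.normSq_eq_conj_mul_self, Complex.normSq_eq_norm_sq, hζ]; simp
    have e : 1 - starRingEnd ℂ w * z =
        starRingEnd ℂ ζ * (ζ - z) - starRingEnd ℂ (w - ζ) * z := by
      rw [map_sub, mul_sub, hζζ]; ring
    have h2 := norm_sub_norm_le (starRingEnd ℂ ζ * (ζ - z)) (starRingEnd ℂ (w - ζ) * z)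
    rw [← e, norm_mul, norm_mul, Complex.norm_conj, Complex.norm_conj, hζ, one_mul] at h2
    nlinarith [norm_nonneg (w - ζ)]
  rw [peak, norm_mul]
  calc _ ≤ (1 - ‖w‖ ^ 2) / (η - ‖w - ζ‖) * 1 := by
        refine mul_le_mul ?_ (norm_peak_right_le hζ hz) (norm_nonneg _)
          (div_nonneg h0 (by linarith))
        rw [norm_div, norm_one_sub_sq hw]
        have : 0 < η - ‖w - ζ‖ := by linarith
        gcongr
    _ = _ := mul_one _

lemma differentiableOn_peak (hζ : ‖ζ‖ = 1) (hw : ‖w‖ < 1) :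
    DifferentiableOn ℂ (peak ζ w) (Metric.ball 0 1) := by
  intro z hz
  rw [mem_ball_zero_iff] at hz
  have h1 : 1 - starRingEnd ℂ w * z ≠ 0 := by
    rw [← norm_pos_iff]
    linarith [one_sub_norm_le (w := w) hz]
  have h2 : ζ * (1 + ‖ζ - w‖) - z ≠ 0 := by
    rw [← norm_pos_iff]
    exact (norm_sub_pos hζ hw).trans_le (norm_le_norm_sub hζ hz)
  refine DifferentiableAt.differentiableWithinAt ?_
  unfold peak
  fun_prop (disch := assumption)

end Peak

section Sequence

variable {ζ : ℂ} {w : ℕ → ℂ}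

lemma eventually_norm_peak_le (hζ : ‖ζ‖ = 1) (hw : ∀ k, ‖w k‖ < 1)
    (hlim : Tendsto w atTop (𝓝 ζ)) {η ε : ℝ} (hη : 0 < η) (hε : 0 < ε) :
    ∀ᶠ k in atTop, ∀ z, ‖z‖ < 1 → η ≤ ‖ζ - z‖ → ‖peak ζ (w k) z‖ ≤ ε := by
  have h1 : Tendsto (fun k => ‖w k - ζ‖) atTop (𝓝 0) :=
    tendsto_iff_norm_sub_tendsto_zero.1 hlim
  have h2 : Tendsto (fun k => (1 - ‖w k‖ ^ 2) / (η - ‖w k - ζ‖)) atTop (𝓝 0) := by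
    have h := ((hlim.norm.pow 2).const_sub 1).div (h1.const_sub η) (by simpa using hη.ne')
    rw [hζ, sub_zero, one_pow, sub_self, zero_div] at h
    exact h
  filter_upwards [h1.eventually_lt_const hη, h2.eventually_le_const hε] with k hk1 hk2 z hz hzη
  exact (norm_peak_le_away hζ (hw k) hz hzη hk1).trans hk2

/-- Close to ζ the k-th peak is small thanks to its zero there; away from ζ all late peaks are
small. -/
lemma eventually_norm_peak_le_or (hζ : ‖ζ‖ = 1) (hw : ∀ k, ‖w k‖ < 1)
    (hlim : Tendsto w atTop (𝓝 ζ)) {ε : ℝ} (hε : 0 < ε) (k : ℕ) :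
    ∀ᶠ l in atTop, ∀ z, ‖z‖ < 1 → ‖peak ζ (w k) z‖ ≤ ε ∨ ‖peak ζ (w l) z‖ ≤ ε := by
  have hd := norm_sub_pos hζ (hw k)
  filter_upwards [eventually_norm_peak_le hζ hw hlim (η := ε * ‖ζ - w k‖ / 2) (by positivity) hε]
    with l hl z hz
  rcases le_total (ε * ‖ζ - w k‖ / 2) ‖ζ - z‖ with h | h
  · exact Or.inr (hl z hz h)
  · refine Or.inl ((norm_peak_le_near hζ (hw k) hz).trans ?_)
    rw [← mul_div_assoc, div_le_iff₀ hd]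
    linarith

/-- A subsequence of peak functions which are nearly disjoint. -/
lemma exists_seq_peak (hζ : ‖ζ‖ = 1) (hw : ∀ k, ‖w k‖ < 1) (hlim : Tendsto w atTop (𝓝 ζ)) :
    ∃ κ : ℕ → ℕ,
      (∀ z, ‖z‖ < 1 → ∃ j₀, ∀ j, j ≠ j₀ → ‖peak ζ (w (κ j)) z‖ ≤ (1 / 2) ^ (j + 3)) ∧
      ∀ ρ < 1, ∃ J, ∀ j, J ≤ j → ∀ z, ‖z‖ ≤ ρ →
        ‖peak ζ (w (κ j)) z‖ ≤ (1 / 2) ^ (j + 3) := by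
  -- The recursion builds pairs (index, precision exponent). Each new peak is small on a disc of
  -- radius close to 1 and, paired with any earlier one, at most one of the two exceeds the new
  -- precision.
  obtain ⟨f, hfP, hfr⟩ := exists_seq_of_forall_finset_exists
    (fun x : ℕ × ℕ => 3 ≤ x.2 ∧
      ∀ z, ‖z‖ ≤ 1 - (1 / 2) ^ x.2 → ‖peak ζ (w x.1) z‖ ≤ (1 / 2) ^ x.2)
    (fun x y => x.2 < y.2 ∧ ∀ z, ‖z‖ < 1 →
      ‖peak ζ (w x.1) z‖ ≤ (1 / 2) ^ y.2 ∨ ‖peak ζ (w y.1) z‖ ≤ (1 / 2) ^ y.2) (by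
    intro s _
    set m := s.sup Prod.snd + 3
    have hm : (0 : ℝ) < (1 / 2) ^ m := by positivity
    have h1 := eventually_norm_peak_le hζ hw hlim hm hm
    have h2 : ∀ᶠ l in atTop, ∀ x ∈ s, ∀ z, ‖z‖ < 1 →
        ‖peak ζ (w x.1) z‖ ≤ (1 / 2) ^ m ∨ ‖peak ζ (w l) z‖ ≤ (1 / 2) ^ m :=
      (eventually_all_finset s).2 fun x _ => eventually_norm_peak_le_or hζ hw hlim hm x.1
    obtain ⟨l, hl1, hl2⟩ := (h1.and h2).exists
    refine ⟨(l, m), ⟨by simp [m], fun z hz => hl1 z (by linarith) ?_⟩, fun x hx => ⟨?_, ?_⟩⟩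
    · have := norm_sub_norm_le ζ z
      linarith
    · have : x.2 ≤ s.sup Prod.snd := Finset.le_sup (f := Prod.snd) hx
      simp only [m]
      omega
    · exact hl2 x hx)
  have hmono : StrictMono fun j => (f j).2 := fun i j hij => (hfr i j hij).1
  have hge : ∀ j, j + 3 ≤ (f j).2 := by
    intro j
    induction j with
    | zero => simpa using (hfP 0).1
    | succ j ih => have := hmono (Nat.lt_add_one j); simp only at this; omega
  have hanti : ∀ {i j : ℕ}, i ≤ j → ((1 : ℝ) / 2) ^ j ≤ (1 / 2) ^ i := fun h =>
    pow_le_pow_of_le_one (by norm_num) (by norm_num) h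
  refine ⟨fun j => (f j).1, fun z hz => ?_, fun ρ hρ => ?_⟩
  -- If one index exceeds its threshold, the pairwise alternative forces all the others below
  -- theirs.
  · by_cases hex : ∃ j₀, (1 / 2) ^ (j₀ + 3) < ‖peak ζ (w (f j₀).1) z‖
    · obtain ⟨j₀, hj₀⟩ := hex
      refine ⟨j₀, fun j hj => ?_⟩
      have h0 := hanti (hge j₀)
      rcases lt_or_gt_of_ne hj with h | h
      · rcases (hfr j j₀ h).2 z hz with h' | h'
        · exact h'.trans (hanti (by have := hge j₀; omega))
        · linarith
      · rcases (hfr j₀ j h).2 z hz with h' | h'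
        · have := hanti (hmono h).le
          simp only at this
          linarith
        · exact h'.trans (hanti (hge j))
    · push Not at hex
      exact ⟨0, fun j _ => hex j⟩
  · obtain ⟨J, hJ⟩ := exists_pow_lt_of_lt_one (sub_pos.2 hρ) (by norm_num : (1 / 2 : ℝ) < 1)
    refine ⟨J, fun j hj z hz => ((hfP j).2 z ?_).trans (hanti (hge j))⟩
    have := hanti (i := J) (j := (f j).2) (by have := hge j; omega)
    linarith

end Sequence

/-! ### Interpolation along a nearly disjoint sequence of functions -/

/-- The shift by 3 keeps the total leakage 1/4 below the peak height 1/2. -/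
lemma hasSum_half_pow_add_three : HasSum (fun j : ℕ => ((1 : ℝ) / 2) ^ (j + 3)) (1 / 4) := by
  have h := hasSum_geometric_two.mul_right ((1 / 2 : ℝ) ^ 3)
  norm_num at h
  simp only [pow_add]
  norm_num
  exact h

section Interpolation

variable {G : ℕ → ℂ → ℂ} {z : ℂ}

lemma norm_ellInf_apply_le (c : EllInf) (j : ℕ) : ‖c j‖ ≤ ‖c‖ :=
  lp.norm_apply_le_norm ENNReal.top_ne_zero c j

lemma summable_and_tsum_norm_le
    (hG2 : ∀ j z, ‖z‖ < 1 → ‖G j z‖ ≤ 2)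
    (hG : ∀ z, ‖z‖ < 1 → ∃ j₀, ∀ j, j ≠ j₀ → ‖G j z‖ ≤ (1 / 2) ^ (j + 3))
    (hz : ‖z‖ < 1) :
    Summable (fun j => ‖G j z‖) ∧ ∑' j, ‖G j z‖ ≤ 3 := by
  obtain ⟨j₀, h⟩ := hG z hz
  have hs : HasSum (fun j : ℕ => ((1 : ℝ) / 2) ^ (j + 3) + if j = j₀ then 2 else 0)
      (1 / 4 + 2) := hasSum_half_pow_add_three.add (hasSum_ite_eq j₀ 2)
  have hle : ∀ j, ‖G j z‖ ≤ ((1 : ℝ) / 2) ^ (j + 3) + if j = j₀ then 2 else 0 := by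
    intro j
    by_cases hj : j = j₀
    · rw [if_pos hj]
      have := hG2 j z hz
      have : (0 : ℝ) ≤ (1 / 2) ^ (j + 3) := by positivity
      linarith
    · rw [if_neg hj, add_zero]
      exact h j hj
  have hsum := hs.summable.of_nonneg_of_le (fun _ => norm_nonneg _) hle
  refine ⟨hsum, (hsum.tsum_le_tsum hle hs.summable).trans ?_⟩
  rw [hs.tsum_eq]
  norm_num

lemma summable_norm_mul
    (hG2 : ∀ j z, ‖z‖ < 1 → ‖G j z‖ ≤ 2)
    (hG : ∀ z, ‖z‖ < 1 → ∃ j₀, ∀ j, j ≠ j₀ → ‖G j z‖ ≤ (1 / 2) ^ (j + 3))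
    (c : EllInf) (hz : ‖z‖ < 1) : Summable fun j => ‖c j * G j z‖ := by
  refine ((summable_and_tsum_norm_le hG2 hG hz).1.mul_left ‖c‖).of_nonneg_of_le
    (fun _ => norm_nonneg _) fun j => ?_
  rw [norm_mul]
  gcongr
  exact norm_ellInf_apply_le c j

lemma norm_tsum_mul_le
    (hG2 : ∀ j z, ‖z‖ < 1 → ‖G j z‖ ≤ 2)
    (hG : ∀ z, ‖z‖ < 1 → ∃ j₀, ∀ j, j ≠ j₀ → ‖G j z‖ ≤ (1 / 2) ^ (j + 3))
    (c : EllInf) (hz : ‖z‖ < 1) : ‖∑' j, c j * G j z‖ ≤ 3 * ‖c‖ := by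
  have hs := summable_and_tsum_norm_le hG2 hG hz
  calc _ ≤ ∑' j, ‖c j * G j z‖ := norm_tsum_le_tsum_norm (summable_norm_mul hG2 hG c hz)
    _ ≤ ∑' j, ‖c‖ * ‖G j z‖ := by
        refine (summable_norm_mul hG2 hG c hz).tsum_le_tsum (fun j => ?_) (hs.1.mul_left _)
        rw [norm_mul]
        gcongr
        exact norm_ellInf_apply_le c j
    _ = ‖c‖ * ∑' j, ‖G j z‖ := tsum_mul_left
    _ ≤ ‖c‖ * 3 := by gcongr; exact hs.2
    _ = _ := mul_comm _ _

/-- A value of at least 1/2 identifies j as the exceptional index at z; the remaining terms add up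
to at most ‖c‖ / 4. -/
lemma half_norm_le_norm_tsum_add
    (hG2 : ∀ j z, ‖z‖ < 1 → ‖G j z‖ ≤ 2)
    (hG : ∀ z, ‖z‖ < 1 → ∃ j₀, ∀ j, j ≠ j₀ → ‖G j z‖ ≤ (1 / 2) ^ (j + 3))
    (c : EllInf) (hz : ‖z‖ < 1) {j : ℕ} (hj : 1 / 2 ≤ ‖G j z‖) :
    1 / 2 * ‖c j‖ ≤ ‖∑' i, c i * G i z‖ + 1 / 4 * ‖c‖ := by
  obtain ⟨j₀, h⟩ := hG z hz
  have hjj : j = j₀ := by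
    by_contra hne
    have h1 := h j hne
    have h2 : ((1 : ℝ) / 2) ^ (j + 3) ≤ (1 / 2) ^ 3 :=
      pow_le_pow_of_le_one (by norm_num) (by norm_num) (by omega)
    norm_num at h2 h1 hj
    linarith
  subst hjj
  have hs := summable_norm_mul hG2 hG c hz
  have hle : ∀ i, ‖(if i = j then 0 else c i * G i z)‖ ≤ ‖c‖ * (1 / 2) ^ (i + 3) := by
    intro i
    split_ifs with hi
    · rw [norm_zero]; positivity
    · rw [norm_mul]
      exact mul_le_mul (norm_ellInf_apply_le c i) (h i hi) (norm_nonneg _) (norm_nonneg _)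
  have hrest := tsum_of_norm_bounded (hasSum_half_pow_add_three.mul_left ‖c‖) hle
  have hsplit := hs.of_norm.tsum_eq_add_tsum_ite j
  calc 1 / 2 * ‖c j‖ ≤ ‖c j * G j z‖ := by
        rw [norm_mul, mul_comm]
        gcongr
    _ = ‖∑' i, c i * G i z - ∑' i, (if i = j then 0 else c i * G i z)‖ := by
        rw [hsplit, add_sub_cancel_right]
    _ ≤ _ := (norm_sub_le _ _).trans (by linarith)

/-- On each smaller disc all but finitely many terms are geometrically small, so convergence is
locally uniform. -/
lemma differentiableOn_tsum_mul
    (hG2 : ∀ j z, ‖z‖ < 1 → ‖G j z‖ ≤ 2)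
    (hd : ∀ j, DifferentiableOn ℂ (G j) (Metric.ball 0 1))
    (hloc : ∀ ρ < 1, ∃ J, ∀ j, J ≤ j → ∀ z, ‖z‖ ≤ ρ → ‖G j z‖ ≤ (1 / 2) ^ (j + 3))
    (c : EllInf) : DifferentiableOn ℂ (fun z => ∑' j, c j * G j z) (Metric.ball 0 1) := by
  intro z hz
  rw [mem_ball_zero_iff] at hz
  obtain ⟨ρ, hzρ, hρ⟩ := exists_between hz
  obtain ⟨J, hJ⟩ := hloc ρ hρ
  have hball : Metric.ball (0 : ℂ) ρ ⊆ Metric.ball 0 1 := Metric.ball_subset_ball hρ.le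
  set v : ℕ → ℝ := fun j => if j < J then 2 else 0
  have hv : Summable v := summable_of_ne_finset_zero (s := Finset.range J) fun j hj => by
    exact if_neg fun h => hj (Finset.mem_range.2 h)
  have hu : Summable fun j : ℕ => ‖c‖ * ((1 / 2) ^ (j + 3) + v j) :=
    (hasSum_half_pow_add_three.summable.add hv).mul_left _
  have h := Complex.differentiableOn_tsum_of_summable_norm (F := fun j z => c j * G j z)
    hu (fun j => ((hd j).mono hball).const_mul _) Metric.isOpen_ball (fun j x hx => ?_)
  · exact (h.differentiableAt (Metric.isOpen_ball.mem_nhds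
      (mem_ball_zero_iff.2 hzρ))).differentiableWithinAt
  · rw [mem_ball_zero_iff] at hx
    rw [norm_mul]
    have hp : (0 : ℝ) ≤ (1 / 2) ^ (j + 3) := by positivity
    refine mul_le_mul (norm_ellInf_apply_le c j) ?_ (norm_nonneg _) (norm_nonneg _)
    by_cases hj : j < J
    · simp only [v, if_pos hj]
      linarith [hG2 j x (hx.trans hρ)]
    · simp only [v, if_neg hj, add_zero]
      exact hJ j (not_lt.1 hj) x hx.le

end Interpolation

/-! ### Fixing a copy of ℓ^∞, and the equivalence -/

lemma Hinf_ext {f g : Hinf} (h : ∀ s, valueAt f s = valueAt g s) : f = g :=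
  Subtype.ext (lp.ext (funext h))

/-- With Z the range of S, a lower bound for T ∘ S bounds below both S and the restriction of T to
Z. -/
lemma fixesCopyOf_of_norm_le {E X Y : Type*} [NormedAddCommGroup E] [NormedSpace ℂ E]
    [NormedAddCommGroup X] [NormedSpace ℂ X] [NormedAddCommGroup Y] [NormedSpace ℂ Y]
    {T : X →L[ℂ] Y} (S : E →L[ℂ] X) {C : ℝ} (hC : 0 ≤ C) (h : ∀ x, ‖x‖ ≤ C * ‖T (S x)‖) :
    FixesCopyOf E T := by
  have hS : Function.Injective (S : E →ₗ[ℂ] X) := by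
    refine (injective_iff_map_eq_zero _).2 fun x hx => ?_
    have := h x
    rw [show S x = 0 from hx, map_zero, norm_zero, mul_zero] at this
    exact norm_le_zero_iff.1 this
  set Z := LinearMap.range (S : E →ₗ[ℂ] X)
  set e₀ : E ≃ₗ[ℂ] Z := LinearEquiv.ofInjective (S : E →ₗ[ℂ] X) hS
  have he₀ : ∀ x, (e₀ x : X) = S x := fun x => rfl
  have hZ : ∀ z : Z, ‖(z : X)‖ ≤ ‖S‖ * C * ‖T z‖ := by
    rintro ⟨_, x, rfl⟩
    calc ‖S x‖ ≤ ‖S‖ * ‖x‖ := S.le_opNorm x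
      _ ≤ ‖S‖ * (C * ‖T (S x)‖) := by gcongr; exact h x
      _ = _ := by rw [mul_assoc]; rfl
  set T₀ : Z →ₗ[ℂ] Z.map (T : X →ₗ[ℂ] Y) :=
    ((T : X →ₗ[ℂ] Y).comp Z.subtype).codRestrict _ fun z => ⟨z, z.2, rfl⟩
  have hT₀ : ∀ z, (T₀ z : Y) = T z := fun z => rfl
  have hbij : Function.Bijective T₀ := by
    refine ⟨(injective_iff_map_eq_zero _).2 fun z hz => ?_, ?_⟩
    · have := hZ z
      rw [← hT₀, hz, Submodule.coe_zero, norm_zero, mul_zero] at this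
      exact Subtype.ext (norm_le_zero_iff.1 this)
    · rintro ⟨_, x, hx, rfl⟩
      exact ⟨⟨x, hx⟩, rfl⟩
  refine ⟨Z, ⟨e₀.symm.toContinuousLinearEquivOfBounds (C * ‖T‖) ‖S‖ (fun z => ?_) fun x => ?_⟩,
    (LinearEquiv.ofBijective T₀ hbij).toContinuousLinearEquivOfBounds ‖T‖ (‖S‖ * C)
      (fun z => ?_) (fun y => ?_), fun z => rfl⟩
  · obtain ⟨x, rfl⟩ := e₀.surjective z
    rw [e₀.symm_apply_apply, mul_assoc]
    refine (h x).trans ?_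
    gcongr
    exact T.le_opNorm _
  · exact S.le_opNorm x
  · exact T.le_opNorm _
  · obtain ⟨z, rfl⟩ := (LinearEquiv.ofBijective T₀ hbij).surjective y
    rw [LinearEquiv.symm_apply_apply]
    exact hZ z

theorem fixesCopyOf_of_forall_exists_re_le {Φ : RightHalfPlane → RightHalfPlane}
    {T : Hinf →L[ℂ] Hinf} (hT : IsCompositionOperator Φ T)
    (hΦ : ∀ ε : ℝ, 0 < ε → ∃ s, (Φ s : ℂ).re ≤ ε) : FixesCopyOf EllInf T := by
  choose s hs using fun k : ℕ => hΦ (1 / ((k : ℝ) + 1)) Nat.one_div_pos_of_nat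
  set x : ℕ → ℂ := fun k => (2 : ℂ) ^ (-(Φ (s k) : ℂ)) with hx
  have hnorm : ∀ z : RightHalfPlane, ‖(2 : ℂ) ^ (-(z : ℂ))‖ = (2 : ℝ) ^ (-(z : ℂ).re) := by
    intro z
    have h := norm_natCast_cpow_neg (n := 2) (by norm_num) (z : ℂ)
    push_cast at h
    exact h
  have hlt : ∀ z : RightHalfPlane, ‖(2 : ℂ) ^ (-(z : ℂ))‖ < 1 := by
    intro z
    rw [hnorm]
    exact Real.rpow_lt_one_of_one_lt_of_neg (by norm_num) (neg_lt_zero.2 z.2)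
  obtain ⟨ζ, -, ψ, hψ, hlim⟩ := (isCompact_closedBall (0 : ℂ) 1).tendsto_subseq
    (x := x) (fun k => mem_closedBall_zero_iff.2 (hlt _).le)
  have hre : Tendsto (fun k => (Φ (s k) : ℂ).re) atTop (𝓝 0) :=
    squeeze_zero (fun k => le_of_lt (Φ (s k)).2) hs tendsto_one_div_add_atTop_nhds_zero_nat
  have hζ : ‖ζ‖ = 1 := by
    have h1 : Tendsto (fun k => ‖x k‖) atTop (𝓝 1) := by
      simp only [hx, hnorm]
      have := (Real.continuous_const_rpow (a := 2) (by norm_num)).continuousAt.tendsto.comp hre.neg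
      rw [neg_zero, Real.rpow_zero] at this
      exact this
    exact tendsto_nhds_unique hlim.norm (h1.comp hψ.tendsto_atTop)
  have hw : ∀ k, ‖(x ∘ ψ) k‖ < 1 := fun k => hlt _
  obtain ⟨κ, hκ1, hκ2⟩ := exists_seq_peak hζ hw hlim
  set G : ℕ → ℂ → ℂ := fun j => peak ζ ((x ∘ ψ) (κ j))
  have hG2 : ∀ j z, ‖z‖ < 1 → ‖G j z‖ ≤ 2 := fun j z hz => norm_peak_le hζ (hw _) hz
  have hex : ∀ c : EllInf, ∃ f : Hinf, ∀ s : RightHalfPlane,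
      valueAt f s = ∑' j, c j * G j ((2 : ℂ) ^ (-(s : ℂ))) := fun c =>
    exists_valueAt_eq_comp_two_cpow (M := 3 * ‖c‖)
      (differentiableOn_tsum_mul hG2 (fun j => differentiableOn_peak hζ (hw _)) hκ2 c)
      fun z hz => norm_tsum_mul_le hG2 hκ1 c (mem_ball_zero_iff.1 hz)
  choose E hE using hex
  have hsum : ∀ (c : EllInf) (s : RightHalfPlane),
      Summable fun j => c j * G j ((2 : ℂ) ^ (-(s : ℂ))) := fun c s =>
    (summable_norm_mul hG2 hκ1 c (hlt s)).of_norm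
  set S : EllInf →L[ℂ] Hinf := LinearMap.mkContinuous
    { toFun := E
      map_add' := fun c d => Hinf_ext fun s => by
        rw [valueAt_add, hE, hE, hE, ← (hsum c s).tsum_add (hsum d s)]
        simp only [lp.coeFn_add, Pi.add_apply, add_mul]
      map_smul' := fun a c => Hinf_ext fun s => by
        rw [RingHom.id_apply, valueAt_smul, hE, hE, ← tsum_mul_left]
        simp only [lp.coeFn_smul, Pi.smul_apply, smul_eq_mul, mul_assoc] } 3
    (fun c => norm_le_of_forall_norm_valueAt_le (by positivity) fun s => by
      change ‖valueAt (E c) s‖ ≤ _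
      rw [hE]
      exact norm_tsum_mul_le hG2 hκ1 c (hlt s))
  refine fixesCopyOf_of_norm_le S (C := 4) (by norm_num) fun c => ?_
  -- The function T (S c), evaluated where Φ hits the j-th peak, gives |c j| / 2 ≤ ‖T (S c)‖ + ‖c‖ /
  -- 4; absorbing ‖c‖ / 2 yields the constant 4.
  have hc : ‖c‖ ≤ 2 * ‖T (S c)‖ + 1 / 2 * ‖c‖ := by
    refine lp.norm_le_of_forall_le (by positivity) fun j => ?_
    have h1 := half_norm_le_norm_tsum_add hG2 hκ1 c (hw (κ j)) (j := j)
      (half_le_norm_peak_self hζ (hw _))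
    have h2 := norm_valueAt_le (T (S c)) (s (ψ (κ j)))
    rw [hT, show valueAt (S c) _ = _ from hE c _] at h2
    have h3 : ‖∑' i, c i * G i ((x ∘ ψ) (κ j))‖ ≤ ‖T (S c)‖ := h2
    linarith
  linarith

end DirichletHardy

end

theorem mainTheorem4
    (Φ : DirichletHardy.RightHalfPlane → DirichletHardy.RightHalfPlane)
    (T : DirichletHardy.Hinf →L[ℂ] DirichletHardy.Hinf)
    (hT : DirichletHardy.IsCompositionOperator Φ T) :
    [ ∃ ε : ℝ, 0 < ε ∧
        ∀ s : DirichletHardy.RightHalfPlane, (Φ s : ℂ) ∈ DirichletHardy.halfPlane ε,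
      IsCompactOperator T,
      DirichletHardy.IsWeaklyCompactOperator T,
      ¬ DirichletHardy.FixesCopyOf DirichletHardy.EllInf T ].TFAE := by
  tfae_have 1 → 2 := fun ⟨_, hε, h⟩ =>
    DirichletHardy.isCompactOperator_of_subset_halfPlane hT hε h
  tfae_have 2 → 3 := DirichletHardy.isWeaklyCompactOperator_of_isCompactOperator
  tfae_have 3 → 4 := fun h hfix =>
    DirichletHardy.not_isWeaklyCompactOperator_of_fixesCopyOf hfix h
  tfae_have 4 → 1 := by
    intro h
    by_contra! hΦ
    refine h (DirichletHardy.fixesCopyOf_of_forall_exists_re_le hT fun ε hε => ?_)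
    obtain ⟨s, hs⟩ := hΦ ε hε
    exact ⟨s, not_lt.1 hs⟩
  tfae_finish
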